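/- Conventions. For a segment $[a,b]$, $\mathrm{Diff}^1_+([a,b])$ is the group of orientation preserving $C^1$-diffeomorphisms of $[a,b]$, with the $C^1$-topology. The support of $g$ is the closure of $\{x : g(x)\neq x\}$; $g$ is supported on a set if its support is contained in it. $g$ is without hyperbolic fixed points if $Dg(x)=1$ whenever $g(x)=x$. A subgroup $\Gamma$ is $C^1$-close to the identity if there is a sequence $h_n\in \mathrm{Diff}^1_+([a,b])$ with $h_n g h_n^{-1}\to \mathrm{id}$ in the $C^1$-topology for every $g\in\Gamma$. An isotopy by conjugacy of $\Gamma$ to the identity is a $C^1$-continuous path $h_t\in \mathrm{Diff}^1_+([a,b])$, $t\in[0,1)$, with $h_t g h_t^{-1}\to \mathrm{id}$ in the $C^1$-topology as $t\to 1$, for every $g\in\Gamma$. For a group $K$, $\bigoplus_{\mathbb Z}K$ is the group of finitely supported functions $\mathbb Z\to K$, on which $\mathbb Z$ acts by shifting the factors. Theorem. (1) Let $f\in \mathrm{Diff}^1_+([0,1])$ be without hyperbolic fixed points, let $x_0\in[0,1]$ with $f(x_0)\ne x_0$, and let $I$ be the segment with end points $x_0$ and $f(x_0)$ (a fundamental domain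 of $f$). Let $G\subset \mathrm{Diff}^1_+([0,1])$ be a subgroup all of whose elements are supported on $I$, and suppose that there is an isotopy by conjugacy $(h_t)_{t\in[0,1)}$ of $G$ to the identity such that every $h_t$ is supported on $I$. Then the group $\langle f,G\rangle$ generated by $f$ and $G$ is $C^1$-close to the identity. More precisely, there is an isotopy by conjugacy $(H_t)_{t\in[0,1)}$ of $\langle f,G\rangle$ to the identity such that every $H_t$ is supported on the support of $f$ and $DH_t(0)=DH_t(1)=1$. Moreover $\langle f,G\rangle\cong\left(\bigoplus_{\mathbb Z}G\right)\rtimes\mathbb Z$ for the shift action, by an isomorphism under which $f$ corresponds to the generator $1$ of $\mathbb Z$ and $G$ to the factor of index $0$. (2) Let $I\subset(0,1)$ be a (non-degenerate) segment, let $G\subset \mathrm{Diff}^1_+(I)$ be a subgroup that is $C^1$-close to the identity (in $\mathrm{Diff}^1_+(I)$), and let $f\in \mathrm{Diff}^1_+([0,1])$ be without hyperbolic fixed points and such that $f(I)\cap I=\emptyset$. Then the elements of $G$, extended by the identity outside $I$, belong to $\mathrm{Diff}^1_+([0,1])$, and, with $G$ so regarded as a subgroup of $\mathrm{Diff}^1_+([0,1])$,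 all the conclusions of (1) hold for $\langle f,G\rangle$. -/

import Mathlib

noncomputable section

namespace C1Close

open Set Filter Topology

/-- An increasing bijection of the segment `[a,b]`, extended by the identity to the real line. -/
def extend {a b : ℝ} (φ : Icc a b ≃o Icc a b) (x : ℝ) : ℝ :=
  open Classical in if h : x ∈ Icc a b then (φ ⟨x, h⟩ : ℝ) else x

theorem extend_coe {a b : ℝ} (φ : Icc a b ≃o Icc a b) (x : Icc a b) :
    extend φ x = φ x := by
  simp only [extend, dif_pos x.2]

theorem extend_mapsTo {a b : ℝ} (φ : Icc a b ≃o Icc a b) :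
    MapsTo (extend φ) (Icc a b) (Icc a b) := by
  intro x hx
  have h := extend_coe φ ⟨x, hx⟩
  simp only at h
  rw [h]
  exact (φ ⟨x, hx⟩).2

/-- The group `Diff¹₊([a,b])`, as a subgroup of the group of increasing homeomorphisms of `[a,b]`
(that is, of order isomorphisms) under composition: the map and its inverse are of class `C¹` on
`[a,b]`, end points included. -/
def diffSubgroup (a b : ℝ) : Subgroup (Icc a b ≃o Icc a b) where
  carrier := {φ | ContDiffOn ℝ 1 (extend φ) (Icc a b) ∧
    ContDiffOn ℝ 1 (extend φ⁻¹) (Icc a b)}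
  one_mem' := by
    have h : ContDiffOn ℝ 1 (extend (1 : Icc a b ≃o Icc a b)) (Icc a b) :=
      contDiffOn_id.congr fun x hx => extend_coe 1 ⟨x, hx⟩
    exact ⟨h, by rw [inv_one]; exact h⟩
  mul_mem' := by
    have key : ∀ φ ψ : Icc a b ≃o Icc a b, ContDiffOn ℝ 1 (extend φ) (Icc a b) →
        ContDiffOn ℝ 1 (extend ψ) (Icc a b) → ContDiffOn ℝ 1 (extend (φ * ψ)) (Icc a b) := by
      intro φ ψ h1 h2
      refine (h1.comp h2 (extend_mapsTo ψ)).congr fun x hx => ?_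
      have e1 := extend_coe (φ * ψ) ⟨x, hx⟩
      have e2 := extend_coe ψ ⟨x, hx⟩
      simp only at e1 e2
      rw [e1, Function.comp_apply, e2, extend_coe φ]
      rfl
    intro φ ψ hφ hψ
    exact ⟨key _ _ hφ.1 hψ.1, by rw [mul_inv_rev]; exact key _ _ hψ.2 hφ.2⟩
  inv_mem' := by
    intro φ hφ
    exact ⟨hφ.2, by rw [inv_inv]; exact hφ.1⟩

/-- `Diff¹₊([a,b])`. -/
abbrev Diff (a b : ℝ) : Type := diffSubgroup a b

/-- The real function on `ℝ` that is `φ` on `[a,b]` and the identity elsewhere. -/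
def Diff.ext {a b : ℝ} (φ : Diff a b) : ℝ → ℝ := extend φ.1

/-- The derivative `Dφ(x)`, `x ∈ [a,b]` (one-sided at the end points). -/
def Diff.D {a b : ℝ} (φ : Diff a b) (x : Icc a b) : ℝ := derivWithin φ.ext (Icc a b) x

theorem Diff.continuous_coe {a b : ℝ} (φ : Diff a b) :
    Continuous fun x : Icc a b => (φ.1 x : ℝ) := by
  have h := continuousOn_iff_continuous_domRestrict.1 φ.2.1.continuousOn
  exact h.congr fun x => extend_coe φ.1 x

theorem Diff.continuous_D {a b : ℝ} (φ : Diff a b) : Continuous φ.D := by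
  rcases lt_or_ge a b with hab | hab
  · exact continuousOn_iff_continuous_domRestrict.1
      (φ.2.1.continuousOn_derivWithin (uniqueDiffOn_Icc hab) le_rfl)
  · have : Subsingleton (Icc a b) :=
      ⟨fun x y => Subtype.ext (by have := x.2.1; have := x.2.2; have := y.2.1; have := y.2.2
                                  linarith)⟩
    exact continuous_of_const fun x y => by rw [Subsingleton.elim x y]

/-- A diffeomorphism together with its derivative, as a pair of continuous functions. -/
def Diff.jet {a b : ℝ} (φ : Diff a b) : C(Icc a b, ℝ) × C(Icc a b, ℝ) :=
  (⟨fun x => (φ.1 x : ℝ), φ.continuous_coe⟩, ⟨φ.D, φ.continuous_D⟩)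

/-- The `C¹`-topology: uniform convergence of the maps and of their derivatives. -/
instance Diff.instTopologicalSpace (a b : ℝ) : TopologicalSpace (Diff a b) :=
  TopologicalSpace.induced Diff.jet inferInstance

/-- The support: the closure of the set of points that are not fixed. -/
def Diff.supp {a b : ℝ} (φ : Diff a b) : Set (Icc a b) := closure {x | φ.1 x ≠ x}

/-- `Dφ = 1` at every fixed point of `φ`. -/
def Diff.NoHyperbolicFixedPoint {a b : ℝ} (φ : Diff a b) : Prop :=
  ∀ x : Icc a b, φ.1 x = x → φ.D x = 1

/-- `Γ` is `C¹`-close to the identity: some sequence `hₙ` in `Diff¹₊([a,b])` satisfies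
`hₙ g hₙ⁻¹ → id` in the `C¹`-topology for every `g ∈ Γ`. -/
def IsC1CloseToId {a b : ℝ} (Γ : Subgroup (Diff a b)) : Prop :=
  ∃ h : ℕ → Diff a b, ∀ g ∈ Γ, Tendsto (fun n => h n * g * (h n)⁻¹) atTop (𝓝 1)

/-- `(h_t)`, `t ∈ [0,1)`, is a `C¹`-continuous path in `Diff¹₊([a,b])` with `h_t g h_t⁻¹ → id` in
the `C¹`-topology as `t → 1`, for every `g ∈ Γ`. (Only the values at `t ∈ [0,1)` matter.) -/
def IsIsotopyByConjugacyToId {a b : ℝ} (h : ℝ → Diff a b) (Γ : Subgroup (Diff a b)) : Prop :=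
  ContinuousOn h (Ico 0 1) ∧
    ∀ g ∈ Γ, Tendsto (fun t => h t * g * (h t)⁻¹) (𝓝[<] 1) (𝓝 1)

/-- The direct sum `⊕_ℤ K` of copies of a (not necessarily abelian) group `K`: the finitely
supported functions `ℤ → K`. -/
def directSum (K : Type) [Group K] : Subgroup (ℤ → K) where
  carrier := {u | (Function.mulSupport u).Finite}
  one_mem' := by simp
  mul_mem' := fun {u v} hu hv => (hu.union hv).subset (Function.mulSupport_mul u v)
  inv_mem' := fun {u} hu => by
    have h : (Function.mulSupport u).Finite := hu
    simpa [Function.mulSupport_inv] using h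

/-- The element of `⊕_ℤ K` equal to `k` at position `0` and trivial elsewhere. -/
def directSum.single {K : Type} [Group K] (k : K) : directSum K :=
  ⟨Pi.mulSingle 0 k, (finite_singleton 0).subset Pi.mulSupport_mulSingle_subset⟩

theorem directSum.shift_mem {K : Type} [Group K] (n : ℤ) (u : directSum K) :
    (fun i => u.1 (i - n)) ∈ directSum K := by
  have h : (Function.mulSupport u.1).Finite := u.2
  exact h.preimage (f := fun i : ℤ => i - n) (sub_left_injective.injOn)

/-- The action of `ℤ` on `⊕_ℤ K` by shifts of the factors: `n` sends the `i`-th factor to the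
`(i+n)`-th one. -/
def directSum.shift (K : Type) [Group K] : Multiplicative ℤ →* MulAut (directSum K) where
  toFun n :=
    { toFun := fun u => ⟨fun i => u.1 (i - n.toAdd), directSum.shift_mem _ u⟩
      invFun := fun u => ⟨fun i => u.1 (i - -n.toAdd), directSum.shift_mem _ u⟩
      left_inv := fun u => by ext i; simp
      right_inv := fun u => by ext i; simp
      map_mul' := fun u v => by ext i; rfl }
  map_one' := by ext u i; simp
  map_mul' := fun m n => by
    ext u i
    simp [sub_sub]

/-- `Γ` is the semidirect product `(⊕_ℤ K) ⋊ ℤ` for the shift action: there is an isomorphism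
sending the generator `1` of `ℤ` to `f` and the `0`-th copy of `K` to `Γ` by `ι`. -/
def IsShiftProduct {M K : Type} [Group M] [Group K] (f : M) (ι : K →* M) (Γ : Subgroup M) : Prop :=
  ∃ e : (directSum K ⋊[directSum.shift K] Multiplicative ℤ) ≃* Γ,
    (e (SemidirectProduct.inr (Multiplicative.ofAdd 1)) : M) = f ∧
      ∀ k : K, (e (SemidirectProduct.inl (directSum.single k)) : M) = ι k

end C1Close

end

/-! By the chain rule the derivative of `H g H⁻¹` at `H x` is `DH(g x) Dg(x) / DH(x)`, and on a
segment uniform closeness of the derivative to 1 already gives C¹-closeness to the identity. So `H`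
conjugates `g` near the identity exactly when `DH` is, up to a small relative error, invariant under
`ρ ↦ (ρ ∘ g) Dg` (`ConjNear`). This condition is convex in `H`: averages of diffeomorphisms can
serve as conjugators, and a sequence of conjugators can be joined by affine segments into an isotopy
(`exists_isotopy`).

After replacing `f` by its inverse if necessary, `x₀ < f x₀`. Let `I = [x₀, f x₀]` and let `k`,
supported on `I`, conjugate elements of `G` near the identity. The conjugator `H` is the normalised
average of the maps `T ∘ fⁱ` with weights `q^(2|i|)`, where `q < 1` is close to 1. Composition with
`f` shifts this average, so `DH(f x) Df(x)` is close to `DH(x)` except for the terms at the ends of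
the sum (`exists_average_shift`). These are negligible because, without hyperbolic fixed points,
`D(fⁿ) ≤ C q^(-|n|)` uniformly (`exists_zpow_d_le`): `log Df` exceeds `ε` by at most a multiple of
the displacement, and along an orbit, which is monotone, the displacements add up to at most the
length of the segment.

For `G`, the map `T` is chosen so that `T ∘ fⁱ = Aᵢ ∘ k` on `I`, with `Aᵢ` a map of `I` onto
`fⁱ(I)`. When the slopes of the `Aᵢ`, up to scale, stay in a compact family of positive functions,
`Aᵢ ∘ k` conjugates `g` near the identity with an estimate uniform in `i`. Bounded ratios of
consecutive translates make it possible to match such slopes at the common end points. Beyond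
finitely many translates `T` is the identity, and the terms of large `|i|` are negligible against
the term of index 0, again by the growth bound (`exists_uniform_glued`, `exists_conjugator`). At
every fixed point of `f`, `T` is tangent to the identity, hence so is `H`; this gives the support
and the end point conditions.

For the group structure, the translates of the interior of `I` are disjoint, so a product of
conjugates `fⁱ g f⁻ⁱ` is determined by its action on each translate, and the exponent of `f` is read
off on the orbit of `x₀`, which avoids these open translates (`isShiftProduct`).

In the second case, elements of `G` have derivative 1 at the ends of the segment, since the
derivative at a common fixed point is invariant under conjugacy; so they extend by the identity. The
conjugators need not be tangent to the identity there, but a fundamental domain containing the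
segment in its interior leaves room to extend them (`exists_extension`). -/

noncomputable section

namespace C1Close

open Set Filter Topology

/-- The derivative of a diffeomorphism, as a function on the real line. -/
def Diff.d {a b : ℝ} (φ : Diff a b) : ℝ → ℝ := derivWithin φ.ext (Icc a b)

/-! ### Chain rule and derivative bounds for diffeomorphisms of a segment -/

namespace Diff

variable {a b : ℝ}

theorem D_eq_d (φ : Diff a b) (x : Icc a b) : φ.D x = φ.d x := rfl

theorem ext_coe (φ : Diff a b) (x : Icc a b) : φ.ext x = φ.1 x := extend_coe φ.1 x

theorem ext_of_mem (φ : Diff a b) {x : ℝ} (hx : x ∈ Icc a b) : φ.ext x = φ.1 ⟨x, hx⟩ :=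
  extend_coe φ.1 ⟨x, hx⟩

theorem ext_of_notMem (φ : Diff a b) {x : ℝ} (hx : x ∉ Icc a b) : φ.ext x = x := by
  simp only [ext, extend, dif_neg hx]

theorem ext_mem (φ : Diff a b) {x : ℝ} (hx : x ∈ Icc a b) : φ.ext x ∈ Icc a b :=
  extend_mapsTo φ.1 hx

theorem ext_mul (φ ψ : Diff a b) (x : ℝ) : (φ * ψ).ext x = φ.ext (ψ.ext x) := by
  by_cases hx : x ∈ Icc a b
  · rw [ext_of_mem _ hx, ext_of_mem ψ hx, ext_coe]
    rfl
  · rw [ext_of_notMem _ hx, ext_of_notMem ψ hx, ext_of_notMem φ hx]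

theorem ext_one (x : ℝ) : (1 : Diff a b).ext x = x := by
  by_cases hx : x ∈ Icc a b
  · rw [ext_of_mem _ hx]
    rfl
  · rw [ext_of_notMem _ hx]

theorem ext_inv_ext (φ : Diff a b) (x : ℝ) : φ⁻¹.ext (φ.ext x) = x := by
  rw [← ext_mul, inv_mul_cancel, ext_one]

theorem ext_ext_inv (φ : Diff a b) (x : ℝ) : φ.ext (φ⁻¹.ext x) = x := by
  rw [← ext_mul, mul_inv_cancel, ext_one]

theorem ext_injective : Function.Injective (ext : Diff a b → ℝ → ℝ) := by
  intro φ ψ h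
  apply Subtype.ext
  apply RelIso.ext
  intro x
  apply Subtype.ext
  rw [← ext_coe, ← ext_coe, h]

theorem eq_of_ext {φ ψ : Diff a b} (h : ∀ x ∈ Icc a b, φ.ext x = ψ.ext x) : φ = ψ := by
  apply ext_injective
  funext x
  by_cases hx : x ∈ Icc a b
  · exact h x hx
  · rw [ext_of_notMem _ hx, ext_of_notMem _ hx]

theorem strictMonoOn_ext (φ : Diff a b) : StrictMonoOn φ.ext (Icc a b) := by
  intro x hx y hy hxy
  rw [ext_of_mem _ hx, ext_of_mem _ hy]
  exact φ.1.strictMono (show (⟨x, hx⟩ : Icc a b) < ⟨y, hy⟩ from hxy)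

theorem strictMono_ext (φ : Diff a b) : StrictMono φ.ext := by
  intro x y hxy
  by_cases hx : x ∈ Icc a b
  · by_cases hy : y ∈ Icc a b
    · exact φ.strictMonoOn_ext hx hy hxy
    · rw [ext_of_notMem _ hy]
      have h1 := φ.ext_mem hx
      have : b < y := by
        by_contra h
        exact hy ⟨hx.1.trans hxy.le, not_lt.1 h⟩
      exact h1.2.trans_lt this
  · by_cases hy : y ∈ Icc a b
    · rw [ext_of_notMem _ hx]
      have h1 := φ.ext_mem hy
      have : x < a := by
        by_contra h
        exact hx ⟨not_lt.1 h, hxy.le.trans hy.2⟩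
      exact this.trans_le h1.1
    · rwa [ext_of_notMem _ hx, ext_of_notMem _ hy]

theorem ext_left (φ : Diff a b) : φ.ext a = a := by
  by_cases h : a ≤ b
  · refine le_antisymm ?_ (φ.ext_mem (left_mem_Icc.2 h)).1
    have h1 := (φ⁻¹.ext_mem (left_mem_Icc.2 h)).1
    have h2 := φ.strictMono_ext.monotone h1
    rwa [ext_ext_inv] at h2
  · exact ext_of_notMem _ fun h' => h (h'.1.trans h'.2)

theorem ext_right (φ : Diff a b) : φ.ext b = b := by
  by_cases h : a ≤ b
  · refine le_antisymm (φ.ext_mem (right_mem_Icc.2 h)).2 ?_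
    have h1 := (φ⁻¹.ext_mem (right_mem_Icc.2 h)).2
    have h2 := φ.strictMono_ext.monotone h1
    rwa [ext_ext_inv] at h2
  · exact ext_of_notMem _ fun h' => h (h'.1.trans h'.2)

theorem hasDerivWithinAt (φ : Diff a b) {x : ℝ} (hx : x ∈ Icc a b) :
    HasDerivWithinAt φ.ext (φ.d x) (Icc a b) x :=
  ((φ.2.1.differentiableOn one_ne_zero) x hx).hasDerivWithinAt

theorem continuousOn_d (hab : a < b) (φ : Diff a b) : ContinuousOn φ.d (Icc a b) :=
  φ.2.1.continuousOn_derivWithin (uniqueDiffOn_Icc hab) le_rfl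

theorem continuousOn_ext (φ : Diff a b) : ContinuousOn φ.ext (Icc a b) := φ.2.1.continuousOn

theorem d_eq (hab : a < b) (φ : Diff a b) {x m : ℝ} (hx : x ∈ Icc a b)
    (h : HasDerivWithinAt φ.ext m (Icc a b) x) : φ.d x = m :=
  h.derivWithin (uniqueDiffOn_Icc hab x hx)

theorem d_mul (hab : a < b) (φ ψ : Diff a b) {x : ℝ} (hx : x ∈ Icc a b) :
    (φ * ψ).d x = φ.d (ψ.ext x) * ψ.d x := by
  apply d_eq hab _ hx
  have h := (φ.hasDerivWithinAt (ψ.ext_mem hx)).comp x (ψ.hasDerivWithinAt hx)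
    (fun y hy => ψ.ext_mem hy)
  exact h.congr (fun y _ => ext_mul _ _ _) (ext_mul _ _ _)

theorem d_eq_one (φ : Diff a b) {p q x : ℝ} (hpq : p < q) (hp : a ≤ p) (hq : q ≤ b)
    (h : ∀ y ∈ Icc p q, φ.ext y = y) (hx : x ∈ Icc p q) : φ.d x = 1 := by
  have hx' : x ∈ Icc a b := ⟨hp.trans hx.1, hx.2.trans hq⟩
  have h1 := (φ.hasDerivWithinAt hx').mono (Icc_subset_Icc hp hq)
  have h2 : HasDerivWithinAt φ.ext 1 (Icc p q) x :=
    (hasDerivWithinAt_id x _).congr h (h x hx)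
  exact (uniqueDiffOn_Icc hpq x hx).eq_deriv _ h1 h2

theorem d_one (hab : a < b) {x : ℝ} (hx : x ∈ Icc a b) : (1 : Diff a b).d x = 1 :=
  d_eq_one _ hab le_rfl le_rfl (fun _ _ => ext_one _) hx

/-- Monotonicity gives only a nonnegative derivative; it cannot vanish, being a factor of `D(φ⁻¹ ∘
φ) = 1`. -/
theorem d_pos (hab : a < b) (φ : Diff a b) {x : ℝ} (hx : x ∈ Icc a b) : 0 < φ.d x := by
  have h0 : 0 ≤ φ.d x := by
    exact (φ.strictMono_ext.monotone.monotoneOn _).derivWithin_nonneg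
  have h1 : (φ⁻¹ * φ).d x = 1 := by rw [inv_mul_cancel, d_one hab hx]
  rw [d_mul hab _ _ hx] at h1
  exact h0.lt_of_ne fun h => by rw [← h, mul_zero] at h1; exact zero_ne_one h1

theorem d_inv (hab : a < b) (φ : Diff a b) {x : ℝ} (hx : x ∈ Icc a b) :
    φ⁻¹.d x = (φ.d (φ⁻¹.ext x))⁻¹ := by
  have h1 : (φ * φ⁻¹).d x = 1 := by rw [mul_inv_cancel, d_one hab hx]
  rw [d_mul hab _ _ hx] at h1
  exact eq_inv_of_mul_eq_one_right h1

theorem exists_d_le (hab : a < b) (φ : Diff a b) : ∃ C, 0 < C ∧ ∀ x ∈ Icc a b, φ.d x ≤ C := by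
  obtain ⟨x, hx, h⟩ := isCompact_Icc.exists_isMaxOn (nonempty_Icc.2 hab.le) (φ.continuousOn_d hab)
  exact ⟨φ.d x, φ.d_pos hab hx, fun y hy => h hy⟩

theorem exists_le_d (hab : a < b) (φ : Diff a b) : ∃ c, 0 < c ∧ ∀ x ∈ Icc a b, c ≤ φ.d x := by
  obtain ⟨x, hx, h⟩ := isCompact_Icc.exists_isMinOn (nonempty_Icc.2 hab.le) (φ.continuousOn_d hab)
  exact ⟨φ.d x, φ.d_pos hab hx, fun y hy => h hy⟩

theorem ext_sub_le (hab : a < b) (φ : Diff a b) {C : ℝ} (hC : ∀ x ∈ Icc a b, φ.d x ≤ C)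
    {x y : ℝ} (hx : a ≤ x) (hxy : x ≤ y) (hy : y ≤ b) : φ.ext y - φ.ext x ≤ C * (y - x) := by
  have h := (convex_Icc a b).norm_image_sub_le_of_norm_hasDerivWithin_le (f := φ.ext) (f' := φ.d)
    (C := C) (fun z hz => φ.hasDerivWithinAt hz)
    (fun z hz => by rw [Real.norm_of_nonneg (φ.d_pos hab hz).le]; exact hC z hz)
    (x := x) (y := y) ⟨hx, hxy.trans hy⟩ ⟨hx.trans hxy, hy⟩
  rw [Real.norm_of_nonneg (sub_nonneg.2 hxy)] at h
  exact (le_abs_self _).trans h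

end Diff

/-! ### Gluing C¹ pieces with positive derivative -/

/-- `F` is of class `C¹` on `[p,q]` with positive derivative `F'`. -/
structure PosC1 (F F' : ℝ → ℝ) (p q : ℝ) : Prop where
  deriv : ∀ x ∈ Icc p q, HasDerivWithinAt F (F' x) (Icc p q) x
  cont : ContinuousOn F' (Icc p q)
  pos : ∀ x ∈ Icc p q, 0 < F' x

namespace PosC1

variable {F F' G G' : ℝ → ℝ} {p q r : ℝ}

theorem congr (h : PosC1 F F' p q) (hF : EqOn G F (Icc p q)) (hF' : EqOn G' F' (Icc p q)) :
    PosC1 G G' p q where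
  deriv x hx := by
    rw [hF' hx]
    exact (h.deriv x hx).congr hF (hF hx)
  cont := h.cont.congr hF'
  pos x hx := by rw [hF' hx]; exact h.pos x hx

theorem union (h₁ : PosC1 F F' p q) (h₂ : PosC1 F F' q r) (hpq : p ≤ q) (hqr : q ≤ r) :
    PosC1 F F' p r where
  deriv x hx := by
    rw [← Icc_union_Icc_eq_Icc hpq hqr]
    rcases lt_trichotomy x q with h | rfl | h
    · have h3 : HasDerivWithinAt F (F' x) (Icc p q) x := h₁.deriv x ⟨hx.1, h.le⟩
      refine h3.mono_of_mem_nhdsWithin ?_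
      rw [Icc_union_Icc_eq_Icc hpq hqr]
      filter_upwards [self_mem_nhdsWithin, mem_nhdsWithin_of_mem_nhds (Iio_mem_nhds h)] with y hy h'
      exact ⟨hy.1, le_of_lt h'⟩
    · exact (h₁.deriv x ⟨hpq, le_rfl⟩).union (h₂.deriv x ⟨le_rfl, hqr⟩)
    · have h3 : HasDerivWithinAt F (F' x) (Icc q r) x := h₂.deriv x ⟨h.le, hx.2⟩
      refine h3.mono_of_mem_nhdsWithin ?_
      rw [Icc_union_Icc_eq_Icc hpq hqr]
      filter_upwards [self_mem_nhdsWithin, mem_nhdsWithin_of_mem_nhds (Ioi_mem_nhds h)] with y hy h'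
      exact ⟨le_of_lt h', hy.2⟩
  cont := by
    rw [← Icc_union_Icc_eq_Icc hpq hqr]
    exact h₁.cont.union_of_isClosed h₂.cont isClosed_Icc isClosed_Icc
  pos x hx := by
    rcases le_total x q with h | h
    · exact h₁.pos x ⟨hx.1, h⟩
    · exact h₂.pos x ⟨h, hx.2⟩

theorem glue (h₁ : PosC1 F F' p q) (h₂ : PosC1 G G' q r) (hpq : p ≤ q) (hqr : q ≤ r)
    (h : F q = G q) (h' : F' q = G' q) :
    ∃ K K' : ℝ → ℝ, PosC1 K K' p r ∧ EqOn K F (Icc p q) ∧ EqOn K' F' (Icc p q) ∧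
      EqOn K G (Icc q r) ∧ EqOn K' G' (Icc q r) := by
  have e1 : EqOn (fun x => if x ≤ q then F x else G x) F (Icc p q) := fun x hx => if_pos hx.2
  have e2 : EqOn (fun x => if x ≤ q then F' x else G' x) F' (Icc p q) := fun x hx => if_pos hx.2
  have e3 : EqOn (fun x => if x ≤ q then F x else G x) G (Icc q r) := fun x hx => by
    rcases hx.1.eq_or_lt with rfl | h3
    · simpa using h
    · exact if_neg (not_le.2 h3)
  have e4 : EqOn (fun x => if x ≤ q then F' x else G' x) G' (Icc q r) := fun x hx => by
    rcases hx.1.eq_or_lt with rfl | h3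
    · simpa using h'
    · exact if_neg (not_le.2 h3)
  exact ⟨_, _, (h₁.congr e1 e2).union (h₂.congr e3 e4) hpq hqr, e1, e2, e3, e4⟩

theorem id (p q : ℝ) : PosC1 (fun x => x) (fun _ => 1) p q where
  deriv x _ := hasDerivWithinAt_id x _
  cont := continuousOn_const
  pos _ _ := one_pos

theorem of_hasDerivAt (h : ∀ x, HasDerivAt F (F' x) x) (hc : Continuous F')
    (hpos : ∀ x ∈ Icc p q, 0 < F' x) : PosC1 F F' p q where
  deriv x _ := (h x).hasDerivWithinAt
  cont := hc.continuousOn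
  pos := hpos

theorem of_diff {a b : ℝ} (hab : a < b) (φ : Diff a b) (hp : a ≤ p) (hq : q ≤ b) :
    PosC1 φ.ext φ.d p q where
  deriv _ hx := (φ.hasDerivWithinAt (Icc_subset_Icc hp hq hx)).mono (Icc_subset_Icc hp hq)
  cont := (φ.continuousOn_d hab).mono (Icc_subset_Icc hp hq)
  pos _ hx := φ.d_pos hab (Icc_subset_Icc hp hq hx)

theorem comp (h₁ : PosC1 G G' q r) {s t : ℝ} (h₂ : PosC1 F F' s t)
    (hm : MapsTo F (Icc s t) (Icc q r)) :
    PosC1 (fun x => G (F x)) (fun x => G' (F x) * F' x) s t where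
  deriv x hx := (h₁.deriv _ (hm hx)).comp x (h₂.deriv x hx) hm
  cont := (h₁.cont.comp (fun x hx => (h₂.deriv x hx).continuousWithinAt) hm).mul h₂.cont
  pos x hx := mul_pos (h₁.pos _ (hm hx)) (h₂.pos x hx)

theorem continuousOn (h : PosC1 F F' p q) : ContinuousOn F (Icc p q) :=
  fun x hx => (h.deriv x hx).continuousWithinAt

theorem strictMonoOn (h : PosC1 F F' p q) : StrictMonoOn F (Icc p q) := by
  refine strictMonoOn_of_deriv_pos (convex_Icc p q) h.continuousOn fun x hx => ?_
  have hx' := interior_subset hx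
  have := (h.deriv x hx').hasDerivAt (mem_interior_iff_mem_nhds.1 hx)
  rw [this.deriv]
  exact h.pos x hx'

/-- The end values and the intermediate value theorem give an order isomorphism; positivity of `F'`
makes its inverse C¹. -/
theorem exists_diff {a b : ℝ} (hab : a < b) (h : PosC1 F F' a b) (ha : F a = a) (hb : F b = b) :
    ∃ φ : Diff a b, EqOn φ.ext F (Icc a b) ∧ EqOn φ.d F' (Icc a b) := by
  have hm := h.strictMonoOn
  have hmaps : MapsTo F (Icc a b) (Icc a b) := fun x hx => by
    have h1 := hm.monotoneOn (left_mem_Icc.2 hab.le) hx hx.1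
    have h2 := hm.monotoneOn hx (right_mem_Icc.2 hab.le) hx.2
    rw [ha] at h1
    rw [hb] at h2
    exact ⟨h1, h2⟩
  let F₀ : Icc a b → Icc a b := fun x => ⟨F x, hmaps x.2⟩
  have hF₀ : StrictMono F₀ := fun x y hxy => hm x.2 y.2 hxy
  have hsurj : Function.Surjective F₀ := by
    intro y
    have h1 := intermediate_value_Icc hab.le h.continuousOn
    rw [ha, hb] at h1
    obtain ⟨x, hx, hxy⟩ := h1 y.2
    exact ⟨⟨x, hx⟩, Subtype.ext hxy⟩
  let e : Icc a b ≃o Icc a b := hF₀.orderIsoOfSurjective F₀ hsurj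
  have he : EqOn (extend e) F (Icc a b) := fun x hx => extend_coe e ⟨x, hx⟩
  have hu := uniqueDiffOn_Icc hab
  have c1 : ContDiffOn ℝ 1 (extend e) (Icc a b) := by
    refine ContDiffOn.congr ?_ he
    rw [show (1 : WithTop ℕ∞) = 0 + 1 by simp, contDiffOn_succ_iff_derivWithin hu]
    refine ⟨fun x hx => (h.deriv x hx).differentiableWithinAt, by simp, ?_⟩
    rw [contDiffOn_zero]
    exact h.cont.congr fun x hx => (h.deriv x hx).derivWithin (hu x hx)
  have hinv : ∀ x ∈ Icc a b, F (extend e⁻¹ x) = x := fun x hx => by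
    have h1 : extend e⁻¹ x = (e⁻¹ ⟨x, hx⟩ : Icc a b) := extend_coe e⁻¹ ⟨x, hx⟩
    rw [h1, ← he (e⁻¹ ⟨x, hx⟩ : Icc a b).2, extend_coe]
    exact congrArg Subtype.val (e.apply_symm_apply ⟨x, hx⟩)
  have hcinv : ContinuousOn (extend e⁻¹) (Icc a b) := by
    rw [continuousOn_iff_continuous_domRestrict]
    have : Continuous fun x : Icc a b => ((e⁻¹ : Icc a b ≃o Icc a b) x : ℝ) :=
      continuous_subtype_val.comp (e⁻¹ : Icc a b ≃o Icc a b).continuous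
    exact this.congr fun x => (extend_coe e⁻¹ x).symm
  have hdinv : ∀ x ∈ Icc a b,
      HasDerivWithinAt (extend e⁻¹) (F' (extend e⁻¹ x))⁻¹ (Icc a b) x := by
    intro x hx
    have hx' := extend_mapsTo e⁻¹ hx
    have hne := (h.pos _ hx').ne'
    have h1 := (h.deriv _ hx').hasFDerivWithinAt
    have h2 : HasFDerivWithinAt F
        (ContinuousLinearEquiv.unitsEquivAut ℝ (Units.mk0 _ hne) : ℝ →L[ℝ] ℝ) (Icc a b)
        (extend e⁻¹ x) :=
      h1.congr_fderiv (ContinuousLinearMap.ext_ring (by simp))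
    have h3 := HasFDerivWithinAt.of_local_left_inverse
      (tendsto_nhdsWithin_iff.2 ⟨hcinv x hx, by
        filter_upwards [self_mem_nhdsWithin] with y hy using extend_mapsTo e⁻¹ hy⟩) h2 hx (by
        filter_upwards [self_mem_nhdsWithin] with y hy using hinv y hy)
    have h4 := h3.hasDerivWithinAt
    simpa using h4
  have c2 : ContDiffOn ℝ 1 (extend e⁻¹) (Icc a b) := by
    rw [show (1 : WithTop ℕ∞) = 0 + 1 by simp, contDiffOn_succ_iff_derivWithin hu]
    refine ⟨fun x hx => (hdinv x hx).differentiableWithinAt, by simp, ?_⟩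
    rw [contDiffOn_zero]
    refine ContinuousOn.congr ?_ fun x hx => (hdinv x hx).derivWithin (hu x hx)
    exact (h.cont.comp hcinv (extend_mapsTo e⁻¹)).inv₀ fun x hx =>
      (h.pos _ (extend_mapsTo e⁻¹ hx)).ne'
  refine ⟨⟨e, c1, c2⟩, he, fun x hx => ?_⟩
  exact Diff.d_eq hab _ hx ((h.deriv x hx).congr he (he hx))

end PosC1

/-! ### C¹-convergence of conjugates, expressed by derivatives -/

namespace Diff

variable {a b : ℝ}

/-- The derivative of `H g H⁻¹` differs from `1` by at most `ε`. -/
def ConjNear (ε : ℝ) (H g : Diff a b) : Prop :=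
  ∀ x ∈ Icc a b, |H.d (g.ext x) * g.d x - H.d x| ≤ ε * H.d x

theorem ConjNear.mono {ε δ : ℝ} (hab : a < b) {H g : Diff a b} (h : ConjNear ε H g) (hε : ε ≤ δ) :
    ConjNear δ H g := fun x hx =>
  (h x hx).trans (mul_le_mul_of_nonneg_right hε (H.d_pos hab hx).le)

/-- Substitute `H x` for the variable and clear the denominator `DH(x)`. The cleared form is convex
in `H`. -/
theorem conjNear_iff (hab : a < b) {ε : ℝ} {H g : Diff a b} :
    ConjNear ε H g ↔ ∀ x ∈ Icc a b, |(H * g * H⁻¹).d x - 1| ≤ ε := by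
  have key : ∀ x ∈ Icc a b, (H * g * H⁻¹).d (H.ext x) - 1 =
      (H.d (g.ext x) * g.d x - H.d x) / H.d x := fun x hx => by
    rw [d_mul hab _ _ (H.ext_mem hx), ext_inv_ext, d_mul hab _ _ hx, d_inv hab _ (H.ext_mem hx),
      ext_inv_ext]
    have := (H.d_pos hab hx).ne'
    field_simp
  constructor
  · intro h x hx
    have hy := H⁻¹.ext_mem hx
    have := key _ hy
    rw [ext_ext_inv] at this
    rw [this, abs_div, abs_of_pos (H.d_pos hab hy), div_le_iff₀ (H.d_pos hab hy)]
    exact h _ hy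
  · intro h x hx
    have := h _ (H.ext_mem hx)
    rwa [key x hx, abs_div, abs_of_pos (H.d_pos hab hx), div_le_iff₀ (H.d_pos hab hx)] at this

theorem abs_ext_sub_le (hab : a < b) (φ : Diff a b) {ε : ℝ}
    (h : ∀ x ∈ Icc a b, |φ.d x - 1| ≤ ε) {x : ℝ} (hx : x ∈ Icc a b) :
    |φ.ext x - x| ≤ ε * (b - a) := by
  have h1 := (convex_Icc a b).norm_image_sub_le_of_norm_hasDerivWithin_le
    (f := fun y => φ.ext y - y) (f' := fun y => φ.d y - 1)
    (C := ε) (fun z hz => (φ.hasDerivWithinAt hz).sub (hasDerivWithinAt_id z _))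
    h (left_mem_Icc.2 hab.le) hx
  rw [ext_left, sub_self, sub_zero, Real.norm_eq_abs, Real.norm_of_nonneg (sub_nonneg.2 hx.1)] at h1
  have hε : 0 ≤ ε := (abs_nonneg _).trans (h x hx)
  exact h1.trans (mul_le_mul_of_nonneg_left (by linarith [hx.2]) hε)

/-- All the maps fix `a`, so the mean value inequality turns control of the derivatives into control
of the maps. -/
theorem tendsto_one_iff {ι : Type*} {l : Filter ι} (hab : a < b) {φ : ι → Diff a b} :
    Tendsto φ l (𝓝 1) ↔ ∀ ε > 0, ∀ᶠ n in l, ∀ x ∈ Icc a b, |(φ n).d x - 1| ≤ ε := by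
  have hind : IsInducing (jet : Diff a b → _) := ⟨rfl⟩
  rw [hind.tendsto_nhds_iff, Prod.tendsto_iff]
  have hne : Nonempty (Icc a b) := ⟨⟨a, left_mem_Icc.2 hab.le⟩⟩
  constructor
  · rintro ⟨-, h⟩ ε hε
    rw [Metric.tendsto_nhds] at h
    filter_upwards [h ε hε] with n hn x hx
    have h1 := (ContinuousMap.dist_apply_le_dist ⟨x, hx⟩).trans hn.le
    have h2 : dist ((φ n).d x) ((1 : Diff a b).d x) ≤ ε := h1
    rwa [d_one hab hx, Real.dist_eq] at h2
  · intro h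
    constructor
    · rw [Metric.tendsto_nhds]
      intro ε hε
      have hba : 0 < b - a := sub_pos.2 hab
      filter_upwards [h (ε / 2 / (b - a)) (by positivity)] with n hn
      refine lt_of_le_of_lt ?_ (half_lt_self hε)
      rw [ContinuousMap.dist_le (by positivity)]
      rintro ⟨x, hx⟩
      have h1 := abs_ext_sub_le hab _ hn hx
      rw [div_mul_cancel₀ _ hba.ne', ext_of_mem _ hx] at h1
      exact h1
    · rw [Metric.tendsto_nhds]
      intro ε hε
      filter_upwards [h (ε / 2) (by positivity)] with n hn
      refine lt_of_le_of_lt ?_ (half_lt_self hε)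
      rw [ContinuousMap.dist_le (by positivity)]
      rintro ⟨x, hx⟩
      have h1 := hn x hx
      rw [← d_one hab hx, ← Real.dist_eq] at h1
      exact h1

theorem tendsto_conj_iff {ι : Type*} {l : Filter ι} (hab : a < b) {H : ι → Diff a b}
    {g : Diff a b} :
    Tendsto (fun n => H n * g * (H n)⁻¹) l (𝓝 1) ↔ ∀ ε > 0, ∀ᶠ n in l, ConjNear ε (H n) g := by
  simp only [tendsto_one_iff hab, conjNear_iff hab]

/-- The elements conjugated to the identity in the limit form a subgroup. -/
theorem tendsto_conj_closure {ι : Type*} {l : Filter ι} (hab : a < b) {H : ι → Diff a b}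
    {S : Set (Diff a b)} (h : ∀ g ∈ S, ∀ ε > 0, ∀ᶠ n in l, ConjNear ε (H n) g) {g : Diff a b}
    (hg : g ∈ Subgroup.closure S) : ∀ ε > 0, ∀ᶠ n in l, ConjNear ε (H n) g := by
  have hmul : ∀ φ ψ : ι → Diff a b, Tendsto φ l (𝓝 1) → Tendsto ψ l (𝓝 1) →
      Tendsto (fun n => φ n * ψ n) l (𝓝 1) := by
    intro φ ψ h1 h2
    rw [tendsto_one_iff hab] at *
    intro ε hε
    have hδ : 0 < min (ε / 3) 1 := by positivity
    filter_upwards [h1 _ hδ, h2 _ hδ] with n hn1 hn2 x hx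
    rw [d_mul hab _ _ hx]
    have e1 := (hn1 _ ((ψ n).ext_mem hx)).trans (min_le_left _ _)
    have e2 := (hn2 x hx).trans (min_le_left _ _)
    have e3 := (hn2 x hx).trans (min_le_right _ _)
    generalize (φ n).d ((ψ n).ext x) = u at *
    generalize (ψ n).d x = v at *
    have e4 : |u * v - 1| ≤ |u - 1| * |v - 1| + |u - 1| + |v - 1| := by
      rw [← abs_mul]
      have : u * v - 1 = (u - 1) * (v - 1) + (u - 1) + (v - 1) := by ring
      rw [this]
      exact abs_add_three _ _ _
    have e5 : |u - 1| * |v - 1| ≤ |u - 1| * 1 := mul_le_mul_of_nonneg_left e3 (abs_nonneg _)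
    linarith
  have hinv : ∀ φ : ι → Diff a b, Tendsto φ l (𝓝 1) → Tendsto (fun n => (φ n)⁻¹) l (𝓝 1) := by
    intro φ h1
    rw [tendsto_one_iff hab] at *
    intro ε hε
    have hδ : 0 < min (ε / 2) (1 / 2) := by positivity
    filter_upwards [h1 _ hδ] with n hn x hx
    rw [d_inv hab _ hx]
    have e1 := hn _ ((φ n)⁻¹.ext_mem hx)
    have e2 := e1.trans (min_le_left _ _)
    have e3 := e1.trans (min_le_right _ _)
    have hp := (φ n).d_pos hab ((φ n)⁻¹.ext_mem hx)
    generalize (φ n).d ((φ n)⁻¹.ext x) = u at *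
    have e4 : 1 / 2 ≤ u := by linarith [(abs_le.1 e3).1]
    have e5 : u⁻¹ - 1 = -(u - 1) / u := by field_simp; ring
    rw [e5, abs_div, abs_neg, abs_of_pos hp, div_le_iff₀ hp]
    nlinarith
  rw [← tendsto_conj_iff hab]
  induction hg using Subgroup.closure_induction with
  | mem g hg => exact (tendsto_conj_iff hab).2 (h g hg)
  | one => simpa using tendsto_const_nhds
  | mul x y _ _ hx hy =>
    refine (hmul _ _ hx hy).congr fun n => by group
  | inv x _ hx =>
    refine (hinv _ hx).congr fun n => by group

/-- Finite convex combinations of diffeomorphisms are diffeomorphisms. -/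
theorem exists_convexCombination {ι : Type*} (hab : a < b) (s : Finset ι) (w : ι → ℝ)
    (φ : ι → Diff a b) (hw : ∀ i ∈ s, 0 ≤ w i) (hw1 : ∑ i ∈ s, w i = 1) :
    ∃ ψ : Diff a b, (∀ x ∈ Icc a b, ψ.ext x = ∑ i ∈ s, w i * (φ i).ext x) ∧
      ∀ x ∈ Icc a b, ψ.d x = ∑ i ∈ s, w i * (φ i).d x := by
  have hP : PosC1 (fun x => ∑ i ∈ s, w i * (φ i).ext x) (fun x => ∑ i ∈ s, w i * (φ i).d x) a b := by
    refine ⟨fun x hx => ?_, ?_, fun x hx => ?_⟩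
    · exact HasDerivWithinAt.fun_sum fun i _ => ((φ i).hasDerivWithinAt hx).const_mul (w i)
    · exact continuousOn_finsetSum _ fun i _ => ((φ i).continuousOn_d hab).const_mul _
    · refine Finset.sum_pos' (fun i hi => mul_nonneg (hw i hi) ((φ i).d_pos hab hx).le) ?_
      have : ∃ i ∈ s, 0 < w i := by
        by_contra! h
        linarith [Finset.sum_nonpos h]
      obtain ⟨i, hi, hwi⟩ := this
      exact ⟨i, hi, mul_pos hwi ((φ i).d_pos hab hx)⟩
  exact hP.exists_diff hab (by simp only [ext_left, ← Finset.sum_mul, hw1, one_mul])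
    (by simp only [ext_right, ← Finset.sum_mul, hw1, one_mul])

/-- Phrased with jets because they induce the topology: an affine path of jets is a continuous path
of diffeomorphisms. -/
theorem exists_segment (hab : a < b) (φ ψ : Diff a b) (s : ℝ) (h0 : 0 ≤ s) (h1 : s ≤ 1) :
    ∃ η : Diff a b, η.jet = (1 - s) • φ.jet + s • ψ.jet := by
  obtain ⟨η, hη, hη'⟩ := exists_convexCombination hab (Finset.univ : Finset Bool)
    (fun i => if i then s else 1 - s) (fun i => if i then ψ else φ)
    (fun i _ => by split_ifs <;> linarith) (by simp)
  refine ⟨η, Prod.ext ?_ ?_⟩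
  · ext ⟨x, hx⟩
    have h2 := hη x hx
    simp only [Fintype.sum_bool, if_true, Bool.false_eq_true, if_false, ext_of_mem _ hx] at h2
    simp [jet]
    linarith
  · ext ⟨x, hx⟩
    have h2 := hη' x hx
    simp only [Fintype.sum_bool, if_true, Bool.false_eq_true, if_false] at h2
    simp [jet, D_eq_d]
    linarith

end Diff

/-! ### From a sequence of conjugators to an isotopy -/

/-- The piecewise affine path through the points `v n` at the times `n`. -/
def affinePath {E : Type*} [AddCommGroup E] [Module ℝ E] (v : ℕ → E) (u : ℝ) : E :=
  (1 - (u - ⌊u⌋₊)) • v ⌊u⌋₊ + (u - ⌊u⌋₊) • v (⌊u⌋₊ + 1)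

theorem continuousOn_affinePath {E : Type*} [AddCommGroup E] [Module ℝ E] [TopologicalSpace E]
    [ContinuousAdd E] [ContinuousSMul ℝ E] (v : ℕ → E) : ContinuousOn (affinePath v) (Ici 0) := by
  have h1 : ∀ m : ℕ, ContinuousOn (affinePath v) (Icc (m : ℝ) (m + 1)) := by
    intro m
    have hc : Continuous fun u : ℝ => (1 - (u - m)) • v m + (u - m) • v (m + 1) := by fun_prop
    refine hc.continuousOn.congr fun u hu => ?_
    rcases hu.2.eq_or_lt with h | h
    -- At the right end the floor has already jumped, but both formulas give `v (m + 1)`.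
    · have : ⌊u⌋₊ = m + 1 := by rw [h]; exact_mod_cast Nat.floor_natCast (R := ℝ) (m + 1)
      rw [affinePath, this, h]
      simp
    · have : ⌊u⌋₊ = m := (Nat.floor_eq_iff ((Nat.cast_nonneg m).trans hu.1)).2 ⟨hu.1, h⟩
      simp [affinePath, this]
  have h2 : ∀ m : ℕ, ContinuousOn (affinePath v) (Icc (0 : ℝ) m) := by
    intro m
    induction m with
    | zero => simp
    | succ m ih =>
      have h3 := ih.union_of_isClosed (h1 m) isClosed_Icc isClosed_Icc
      rwa [Icc_union_Icc_eq_Icc (Nat.cast_nonneg m) (by linarith), ← Nat.cast_succ] at h3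
  intro u hu
  obtain ⟨m, hm⟩ := exists_nat_gt u
  refine (h2 m u ⟨hu, hm.le⟩).mono_of_mem_nhdsWithin ?_
  filter_upwards [self_mem_nhdsWithin, mem_nhdsWithin_of_mem_nhds (Iio_mem_nhds hm)] with y hy h'
  exact ⟨hy, le_of_lt h'⟩

namespace Diff

variable {a b : ℝ}

/-- A sequence conjugating to the identity can be interpolated to an isotopy. -/
theorem exists_isotopy (hab : a < b) (H : ℕ → Diff a b) (S : Set (Diff a b))
    (hS : ∀ g ∈ S, ∀ ε > 0, ∀ᶠ n in atTop, ConjNear ε (H n) g) :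
    ∃ K : ℝ → Diff a b, IsIsotopyByConjugacyToId K (Subgroup.closure S) ∧
      ∀ t, ∃ n, ∃ s : ℝ, (∀ x ∈ Icc a b, (K t).ext x = (1 - s) * (H n).ext x + s * (H (n + 1)).ext x) ∧
        ∀ x ∈ Icc a b, (K t).d x = (1 - s) * (H n).d x + s * (H (n + 1)).d x := by
  -- The time `1/(1-t)` runs to infinity as `t → 1`. The `max` covers the irrelevant values of `t`,
  -- so that the coefficients lie in `[0,1]` for every `t`.
  let u : ℝ → ℝ := fun t => max 0 (1 - t)⁻¹
  have hu0 : ∀ t, 0 ≤ u t := fun t => le_max_left _ _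
  have hs : ∀ t, 0 ≤ u t - ⌊u t⌋₊ ∧ u t - ⌊u t⌋₊ ≤ 1 := fun t =>
    ⟨by linarith [Nat.floor_le (hu0 t)], by linarith [Nat.lt_floor_add_one (u t)]⟩
  choose K hK using fun t => exists_segment hab (H ⌊u t⌋₊) (H (⌊u t⌋₊ + 1)) _ (hs t).1 (hs t).2
  have hKe : ∀ t, ∀ x ∈ Icc a b, (K t).ext x =
      (1 - (u t - ⌊u t⌋₊)) * (H ⌊u t⌋₊).ext x + (u t - ⌊u t⌋₊) * (H (⌊u t⌋₊ + 1)).ext x := by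
    intro t x hx
    have h := congrArg (fun j : C(Icc a b, ℝ) × C(Icc a b, ℝ) => j.1 ⟨x, hx⟩) (hK t)
    simpa [jet, ← ext_of_mem _ hx] using h
  have hKd : ∀ t, ∀ x ∈ Icc a b, (K t).d x =
      (1 - (u t - ⌊u t⌋₊)) * (H ⌊u t⌋₊).d x + (u t - ⌊u t⌋₊) * (H (⌊u t⌋₊ + 1)).d x := by
    intro t x hx
    have h := congrArg (fun j : C(Icc a b, ℝ) × C(Icc a b, ℝ) => j.2 ⟨x, hx⟩) (hK t)
    simpa [jet, D_eq_d] using h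
  refine ⟨K, ⟨?_, fun g hg => ?_⟩, fun t => ⟨_, _, hKe t, hKd t⟩⟩
  · have hind : IsInducing (jet : Diff a b → _) := ⟨rfl⟩
    rw [hind.continuousOn_iff]
    have h1 : ContinuousOn u (Ico 0 1) := by
      refine ContinuousOn.sup continuousOn_const (ContinuousOn.inv₀ (by fun_prop) fun t ht => ?_)
      have : 0 < 1 - t := by linarith [ht.2]
      exact this.ne'
    exact ((continuousOn_affinePath fun n => (H n).jet).comp h1 fun t _ => hu0 t).congr
      fun t _ => hK t
  · rw [tendsto_conj_iff hab]
    intro ε hε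
    have h1 := tendsto_conj_closure hab hS hg ε hε
    obtain ⟨n₀, hn₀⟩ := eventually_atTop.1 h1
    have h2 : Tendsto (fun t : ℝ => ⌊u t⌋₊) (𝓝[<] 1) atTop := by
      refine tendsto_nat_floor_atTop.comp (tendsto_atTop_mono (fun t => le_max_right _ _) ?_)
      refine tendsto_inv_nhdsGT_zero.comp (tendsto_nhdsWithin_iff.2 ⟨?_, ?_⟩)
      · have : Tendsto (fun t : ℝ => 1 - t) (𝓝 1) (𝓝 (1 - 1)) :=
          (continuous_const.sub continuous_id).tendsto 1
        rw [sub_self] at this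
        exact this.mono_left nhdsWithin_le_nhds
      · filter_upwards [self_mem_nhdsWithin] with t ht
        exact sub_pos.2 (mem_Iio.1 ht)
    filter_upwards [h2.eventually_ge_atTop n₀] with t ht x hx
    rw [hKd t x hx, hKd t _ (g.ext_mem hx)]
    have e1 := hn₀ _ ht x hx
    have e2 := hn₀ (⌊u t⌋₊ + 1) (by omega) x hx
    obtain ⟨hs0, hs1⟩ := hs t
    generalize u t - ⌊u t⌋₊ = s at *
    -- Convexity: the estimates for two consecutive maps combine with coefficients `1 - s` and `s`.
    rw [abs_le] at *
    constructor <;> nlinarith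
end Diff

/-! ### Subexponential growth of the derivatives of iterates -/

namespace Diff

variable {a b : ℝ}

theorem noHyperbolicFixedPoint_iff {f : Diff a b} :
    f.NoHyperbolicFixedPoint ↔ ∀ x ∈ Icc a b, f.ext x = x → f.d x = 1 := by
  constructor
  · intro h x hx hfx
    refine h ⟨x, hx⟩ (Subtype.ext ?_)
    rwa [← ext_of_mem _ hx]
  · intro h x hx
    refine h x x.2 ?_
    rw [ext_coe, hx]

theorem ext_inv_eq_self_iff (f : Diff a b) {x : ℝ} : f⁻¹.ext x = x ↔ f.ext x = x := by
  constructor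
  · intro h
    rw [← h, ext_ext_inv, h]
  · intro h
    rw [← h, ext_inv_ext, h]

theorem NoHyperbolicFixedPoint.inv (hab : a < b) {f : Diff a b} (hf : f.NoHyperbolicFixedPoint) :
    f⁻¹.NoHyperbolicFixedPoint := by
  rw [noHyperbolicFixedPoint_iff] at *
  intro x hx h
  rw [d_inv hab _ hx, h, hf x hx ((ext_inv_eq_self_iff f).1 h), inv_one]

/-- The compact set where `Df ≥ exp ε` contains no fixed point, so the displacement is bounded below
there; a large multiple of it dominates the maximum of `Df`. -/
theorem NoHyperbolicFixedPoint.exists_d_le_exp (hab : a < b) {f : Diff a b}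
    (hf : f.NoHyperbolicFixedPoint) {ε : ℝ} (hε : 0 < ε) :
    ∃ C, 0 ≤ C ∧ ∀ x ∈ Icc a b, f.d x ≤ Real.exp (ε + C * |f.ext x - x|) := by
  rw [noHyperbolicFixedPoint_iff] at hf
  have hK : IsCompact (Icc a b ∩ f.d ⁻¹' Ici (Real.exp ε)) :=
    isCompact_Icc.of_isClosed_subset
      ((f.continuousOn_d hab).preimage_isClosed_of_isClosed isClosed_Icc isClosed_Ici)
      inter_subset_left
  rcases (Icc a b ∩ f.d ⁻¹' Ici (Real.exp ε)).eq_empty_or_nonempty with h | h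
  · refine ⟨0, le_rfl, fun x hx => ?_⟩
    by_contra! h1
    have : x ∈ Icc a b ∩ f.d ⁻¹' Ici (Real.exp ε) := ⟨hx, by simpa using h1.le⟩
    simp [h] at this
  · have hc : ContinuousOn (fun x => |f.ext x - x|) (Icc a b ∩ f.d ⁻¹' Ici (Real.exp ε)) :=
      ((f.continuousOn_ext.sub continuousOn_id).abs).mono inter_subset_left
    obtain ⟨y, hy, hmin⟩ := hK.exists_isMinOn h hc
    obtain ⟨M, hM0, hM⟩ := f.exists_d_le hab
    have hδ : 0 < |f.ext y - y| := by
      refine abs_pos.2 fun h1 => ?_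
      have h2 := hf y hy.1 (sub_eq_zero.1 h1)
      have h3 : Real.exp ε ≤ f.d y := hy.2
      rw [h2] at h3
      exact absurd h3 (not_le.2 (Real.one_lt_exp_iff.2 hε))
    refine ⟨M / |f.ext y - y|, by positivity, fun x hx => ?_⟩
    by_cases hxK : Real.exp ε ≤ f.d x
    · have h1 : |f.ext y - y| ≤ |f.ext x - x| := hmin ⟨hx, hxK⟩
      have h2 : M ≤ M / |f.ext y - y| * |f.ext x - x| := by
        rw [div_mul_eq_mul_div, le_div_iff₀ hδ]
        exact mul_le_mul_of_nonneg_left h1 hM0.le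
      calc f.d x ≤ M := hM x hx
        _ ≤ M + 1 := by linarith
        _ ≤ Real.exp M := Real.add_one_le_exp M
        _ ≤ _ := Real.exp_le_exp.2 (by linarith)
    · refine (not_le.1 hxK).le.trans (Real.exp_le_exp.2 ?_)
      have : 0 ≤ M / |f.ext y - y| * |f.ext x - x| := by positivity
      linarith

/-- Orbits of an increasing map are monotone, so displacements have a constant sign and add without
cancellation. -/
theorem abs_pow_ext_sub (f : Diff a b) (x : ℝ) (n : ℕ) :
    |(f ^ (n + 1)).ext x - x| =
      |f.ext ((f ^ n).ext x) - (f ^ n).ext x| + |(f ^ n).ext x - x| := by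
  have e1 : (f ^ (n + 1)).ext x = f.ext ((f ^ n).ext x) := by rw [pow_succ', ext_mul]
  have e2 : (f ^ (n + 1)).ext x = (f ^ n).ext (f.ext x) := by rw [pow_succ, ext_mul]
  rw [← e1]
  rcases le_total x (f.ext x) with h | h
  · have h1 : ∀ m : ℕ, x ≤ (f ^ m).ext x := fun m => by
      induction m with
      | zero => rw [pow_zero, ext_one]
      | succ m ih =>
        rw [pow_succ', ext_mul]
        exact h.trans (f.strictMono_ext.monotone ih)
    have h2 : (f ^ n).ext x ≤ (f ^ (n + 1)).ext x := by
      rw [e2]; exact (f ^ n).strictMono_ext.monotone h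
    rw [abs_of_nonneg (sub_nonneg.2 (h1 _)), abs_of_nonneg (sub_nonneg.2 h2),
      abs_of_nonneg (sub_nonneg.2 (h1 _))]
    ring
  · have h1 : ∀ m : ℕ, (f ^ m).ext x ≤ x := fun m => by
      induction m with
      | zero => rw [pow_zero, ext_one]
      | succ m ih =>
        rw [pow_succ', ext_mul]
        exact (f.strictMono_ext.monotone ih).trans h
    have h2 : (f ^ (n + 1)).ext x ≤ (f ^ n).ext x := by
      rw [e2]; exact (f ^ n).strictMono_ext.monotone h
    rw [abs_of_nonpos (sub_nonpos.2 (h1 _)), abs_of_nonpos (sub_nonpos.2 h2),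
      abs_of_nonpos (sub_nonpos.2 (h1 _))]
    ring

/-- Multiply the bounds `exp (ε + C |f y - y|)` along the orbit. With `ε = -log q` the factor `qⁿ`
cancels the `ε` terms, and the displacements sum to at most `b - a`. -/
theorem NoHyperbolicFixedPoint.exists_pow_d_le (hab : a < b) {f : Diff a b}
    (hf : f.NoHyperbolicFixedPoint) {q : ℝ} (hq : 0 < q) (hq1 : q < 1) :
    ∃ C, 0 < C ∧ ∀ n : ℕ, ∀ x ∈ Icc a b, q ^ n * (f ^ n).d x ≤ C := by
  obtain ⟨C, hC0, hC⟩ := hf.exists_d_le_exp hab (ε := -Real.log q)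
    (neg_pos.2 (Real.log_neg hq hq1))
  refine ⟨Real.exp (C * (b - a)), Real.exp_pos _, fun n x hx => ?_⟩
  have h1 : q ^ n * (f ^ n).d x ≤ Real.exp (C * |(f ^ n).ext x - x|) := by
    induction n with
    | zero => simp [d_one hab hx, ext_one]
    | succ n ih =>
      have hy := (f ^ n).ext_mem hx
      have h2 := hC _ hy
      rw [Real.exp_add, Real.exp_neg, Real.exp_log hq, ← div_eq_inv_mul, le_div_iff₀ hq] at h2
      rw [abs_pow_ext_sub, mul_add, Real.exp_add, pow_succ' f, d_mul hab _ _ hx, pow_succ q]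
      calc q ^ n * q * (f.d ((f ^ n).ext x) * (f ^ n).d x)
          = f.d ((f ^ n).ext x) * q * (q ^ n * (f ^ n).d x) := by ring
        _ ≤ _ := mul_le_mul h2 ih (by have := (f ^ n).d_pos hab hx; positivity)
          (Real.exp_pos _).le
  refine h1.trans (Real.exp_le_exp.2 (mul_le_mul_of_nonneg_left ?_ hC0))
  have h3 := (f ^ n).ext_mem hx
  rw [abs_le]
  constructor <;> linarith [h3.1, h3.2, hx.1, hx.2]

/-- The derivatives of the iterates grow subexponentially, uniformly. -/
theorem NoHyperbolicFixedPoint.exists_zpow_d_le (hab : a < b) {f : Diff a b}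
    (hf : f.NoHyperbolicFixedPoint) {q : ℝ} (hq : 0 < q) (hq1 : q < 1) :
    ∃ C, 0 < C ∧ ∀ n : ℤ, ∀ x ∈ Icc a b, q ^ n.natAbs * (f ^ n).d x ≤ C := by
  obtain ⟨C, hC0, hC⟩ := hf.exists_pow_d_le hab hq hq1
  obtain ⟨C', hC0', hC'⟩ := (hf.inv hab).exists_pow_d_le hab hq hq1
  refine ⟨max C C', by positivity, fun n x hx => ?_⟩
  obtain ⟨m, rfl | rfl⟩ := n.eq_nat_or_neg
  · simpa using (hC m x hx).trans (le_max_left _ _)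
  · simpa using (hC' m x hx).trans (le_max_right _ _)

/-! ### Weighted averages of translates -/

/-- A shift of the index changes each weight by a factor at least `q²`, and otherwise only one term
at either end of the window matters. `R` is chosen so that such a term is at most `1 - q²` times the
term of index 0, hence times the whole sum. -/
theorem exists_average_shift (hab : a < b) (T f : Diff a b) {q C : ℝ} (hq : 0 < q) (hq1 : q < 1)
    (hC0 : 0 < C) (hC : ∀ n : ℤ, ∀ x ∈ Icc a b, q ^ n.natAbs * (f ^ n).d x ≤ C) :
    ∃ R : ℕ, ∀ x ∈ Icc a b,
      q ^ 4 * ∑ i ∈ Finset.Icc (-R : ℤ) R, q ^ (2 * i.natAbs) * (T * f ^ i).d x ≤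
          ∑ i ∈ Finset.Icc (-R : ℤ) R, q ^ (2 * i.natAbs) * (T * f ^ (i + 1)).d x ∧
        q ^ 2 * ∑ i ∈ Finset.Icc (-R : ℤ) R, q ^ (2 * i.natAbs) * (T * f ^ (i + 1)).d x ≤
          (2 - q ^ 2) * ∑ i ∈ Finset.Icc (-R : ℤ) R, q ^ (2 * i.natAbs) * (T * f ^ i).d x := by
  obtain ⟨M, hM0, hM⟩ := T.exists_d_le hab
  obtain ⟨c, hc0, hc⟩ := T.exists_le_d hab
  have hq2 : 0 < 1 - q ^ 2 := by nlinarith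
  obtain ⟨R, hR⟩ := exists_pow_lt_of_lt_one (show 0 < (1 - q ^ 2) * c / (M * C) by positivity) hq1
  rw [lt_div_iff₀ (by positivity)] at hR
  refine ⟨R, fun x hx => ?_⟩
  set D : ℤ → ℝ := fun i => (T * f ^ i).d x with hD
  set w : ℤ → ℝ := fun i => q ^ (2 * i.natAbs) with hw
  have hDpos : ∀ i, 0 < D i := fun i => d_pos hab _ hx
  have hwpos : ∀ i, 0 < w i := fun i => pow_pos hq _
  have hwD : ∀ i, 0 ≤ w i * D i := fun i => (mul_pos (hwpos i) (hDpos i)).le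
  have hend : ∀ i : ℤ, R ≤ i.natAbs → w i * D i ≤ (1 - q ^ 2) * D 0 := by
    intro i hi
    have h1 : D i = T.d ((f ^ i).ext x) * (f ^ i).d x := d_mul hab _ _ hx
    have h2 : c ≤ D 0 := by
      have : D 0 = T.d x := by simp [hD]
      rw [this]
      exact hc x hx
    -- One factor `q^|i|` of the weight compensates the growth of `D(fⁱ)`; the other makes the term
    -- small.
    calc w i * D i = q ^ i.natAbs * (T.d ((f ^ i).ext x) * (q ^ i.natAbs * (f ^ i).d x)) := by
          rw [h1, hw]
          ring
      _ ≤ q ^ R * (M * C) := by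
          have h3 := hM _ ((f ^ i).ext_mem hx)
          have h4 := T.d_pos hab ((f ^ i).ext_mem hx)
          have h5 := hC i x hx
          have h6 := (f ^ i).d_pos hab hx
          have h7 : q ^ i.natAbs ≤ q ^ R := pow_le_pow_of_le_one hq.le hq1.le hi
          gcongr
      _ ≤ (1 - q ^ 2) * c := hR.le
      _ ≤ _ := mul_le_mul_of_nonneg_left h2 hq2.le
  have hstep : ∀ i j : ℤ, j.natAbs ≤ i.natAbs + 1 → q ^ 2 * w i ≤ w j := by
    intro i j hij
    rw [hw]
    simp only
    rw [← pow_add]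
    exact pow_le_pow_of_le_one hq.le hq1.le (by omega)
  have hshift : ∑ i ∈ Finset.Icc (-R : ℤ) R, w i * D (i + 1) =
      ∑ j ∈ Finset.Icc (1 - R : ℤ) (R + 1), w (j - 1) * D j := by
    refine Finset.sum_nbij' (· + 1) (· - 1) ?_ ?_ ?_ ?_ ?_
    · intro i hi; simp only [Finset.mem_Icc] at *; omega
    · intro i hi; simp only [Finset.mem_Icc] at *; omega
    · intro i _; simp
    · intro i _; simp
    · intro i _; simp
  have hS0 : D 0 ≤ ∑ i ∈ Finset.Icc (-R : ℤ) R, w i * D i := by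
    have := Finset.single_le_sum (f := fun i => w i * D i) (fun i _ => hwD i)
      (show (0 : ℤ) ∈ Finset.Icc (-R : ℤ) R by simp)
    simpa [hw] using this
  change q ^ 4 * ∑ i ∈ Finset.Icc (-R : ℤ) R, w i * D i ≤
      ∑ i ∈ Finset.Icc (-R : ℤ) R, w i * D (i + 1) ∧
    q ^ 2 * ∑ i ∈ Finset.Icc (-R : ℤ) R, w i * D (i + 1) ≤
      (2 - q ^ 2) * ∑ i ∈ Finset.Icc (-R : ℤ) R, w i * D i
  set S := ∑ i ∈ Finset.Icc (-R : ℤ) R, w i * D i with hS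
  rw [hshift]
  constructor
  · have h1 : Finset.Icc (-R : ℤ) R = insert (-R : ℤ) (Finset.Icc (1 - R : ℤ) R) := by
      ext i; simp only [Finset.mem_insert, Finset.mem_Icc]; omega
    have h2 : S = w (-R) * D (-R) + ∑ i ∈ Finset.Icc (1 - R : ℤ) R, w i * D i := by
      rw [hS, h1, Finset.sum_insert (by simp)]
    have h3 : ∑ j ∈ Finset.Icc (1 - R : ℤ) R, q ^ 2 * (w j * D j) ≤
        ∑ j ∈ Finset.Icc (1 - R : ℤ) (R + 1), w (j - 1) * D j := by
      refine (Finset.sum_le_sum (g := fun j => w (j - 1) * D j) fun j _ => ?_).trans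
        (Finset.sum_le_sum_of_subset_of_nonneg (Finset.Icc_subset_Icc_right (by omega))
          fun j _ _ => (mul_pos (hwpos _) (hDpos _)).le)
      rw [← mul_assoc]
      exact mul_le_mul_of_nonneg_right (hstep _ _ (by omega)) (hDpos j).le
    rw [← Finset.mul_sum] at h3
    have h4 := hend (-R) (by simp)
    have h5 : q ^ 2 * S ≤ ∑ i ∈ Finset.Icc (1 - R : ℤ) R, w i * D i := by
      have := mul_le_mul_of_nonneg_left hS0 hq2.le
      linarith
    have h6 := mul_le_mul_of_nonneg_left h5 (sq_nonneg q)
    linarith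
  · have h1 : Finset.Icc (-R : ℤ) (R + 1) = insert (R + 1 : ℤ) (Finset.Icc (-R : ℤ) R) := by
      ext i; simp only [Finset.mem_insert, Finset.mem_Icc]; omega
    have h2 : ∑ i ∈ Finset.Icc (-R : ℤ) (R + 1), w i * D i = w (R + 1) * D (R + 1) + S := by
      rw [hS, h1, Finset.sum_insert (by simp)]
    have h3 : ∑ j ∈ Finset.Icc (1 - R : ℤ) (R + 1), q ^ 2 * (w (j - 1) * D j) ≤
        ∑ j ∈ Finset.Icc (-R : ℤ) (R + 1), w j * D j := by
      refine (Finset.sum_le_sum (g := fun j => w j * D j) fun j _ => ?_).trans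
        (Finset.sum_le_sum_of_subset_of_nonneg (Finset.Icc_subset_Icc_left (by omega))
          fun j _ _ => (mul_pos (hwpos _) (hDpos _)).le)
      rw [← mul_assoc]
      exact mul_le_mul_of_nonneg_right (hstep _ _ (by omega)) (hDpos j).le
    rw [← Finset.mul_sum, h2] at h3
    have h4 := hend (R + 1) (by omega)
    have h5 := mul_le_mul_of_nonneg_left hS0 hq2.le
    linarith

end Diff

/-- Uniformity over all finite index sets is needed because the window of summation is chosen after
`N`. -/
theorem exists_geometric_tail_le {q ε : ℝ} (hq : 0 < q) (hq1 : q < 1) (hε : 0 < ε) :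
    ∃ N : ℕ, ∀ t : Finset ℤ, (∀ i ∈ t, N ≤ i.natAbs) → ∑ i ∈ t, q ^ i.natAbs ≤ ε := by
  have hs : Summable fun i : ℤ => q ^ i.natAbs := by
    refine Summable.of_nat_of_neg ?_ ?_ <;>
    simpa using summable_geometric_of_lt_one hq.le hq1
  obtain ⟨s, h⟩ := summable_iff_vanishing_norm.1 hs ε hε
  refine ⟨s.sup Int.natAbs + 1, fun t ht => ?_⟩
  refine (le_abs_self _).trans (h t ?_).le
  rw [Finset.disjoint_left]
  intro i hi his
  have h1 := ht i hi
  have h2 := Finset.le_sup (f := Int.natAbs) his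
  omega

/-- If `D'` is close to `D` at small indices, weighted sums are close. -/
theorem abs_weightedSum_sub_le {q : ℝ} (hq : 0 < q) (s : Finset ℤ) (D D' : ℤ → ℝ) {η δ C : ℝ}
    (N : ℕ) (hD : ∀ i, 0 < D i) (hη : 0 ≤ η)
    (h : ∀ i : ℤ, i.natAbs < N → |D' i - D i| ≤ η * D i)
    (h' : ∀ i : ℤ, N ≤ i.natAbs → q ^ i.natAbs * |D' i - D i| ≤ C)
    (hC : 0 ≤ C)
    (hN : ∀ t : Finset ℤ, (∀ i ∈ t, N ≤ i.natAbs) → ∑ i ∈ t, q ^ i.natAbs ≤ δ) :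
    |∑ i ∈ s, q ^ (2 * i.natAbs) * D' i - ∑ i ∈ s, q ^ (2 * i.natAbs) * D i| ≤
      η * ∑ i ∈ s, q ^ (2 * i.natAbs) * D i + C * δ := by
  have hw : ∀ i : ℤ, 0 < q ^ (2 * i.natAbs) := fun i => pow_pos hq _
  rw [← Finset.sum_sub_distrib]
  refine (Finset.abs_sum_le_sum_abs _ _).trans ?_
  -- Small indices contribute the relative error `η`. For large ones, half of the exponent in
  -- `q^(2|i|)` absorbs the growth of the terms and the other half sums to a small tail.
  rw [← Finset.sum_filter_add_sum_filter_not s fun i : ℤ => i.natAbs < N]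
  refine add_le_add ?_ ?_
  · rw [Finset.mul_sum]
    refine (Finset.sum_le_sum (g := fun i => η * (q ^ (2 * i.natAbs) * D i)) fun i hi => ?_).trans
      (Finset.sum_le_sum_of_subset_of_nonneg (Finset.filter_subset _ _) fun i _ _ =>
        mul_nonneg hη (mul_pos (hw i) (hD i)).le)
    rw [← mul_sub, abs_mul, abs_of_pos (hw i)]
    have := mul_le_mul_of_nonneg_left (h i (Finset.mem_filter.1 hi).2) (hw i).le
    linarith
  · have h1 := hN (s.filter fun i : ℤ => ¬ i.natAbs < N)
      fun i hi => not_lt.1 (Finset.mem_filter.1 hi).2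
    refine le_trans ?_ (mul_le_mul_of_nonneg_left h1 hC)
    rw [Finset.mul_sum]
    refine Finset.sum_le_sum fun i hi => ?_
    rw [← mul_sub, abs_mul, abs_of_pos (hw i), two_mul, pow_add, mul_assoc, mul_comm]
    exact mul_le_mul_of_nonneg_right (h' i (not_lt.1 (Finset.mem_filter.1 hi).2)) (pow_pos hq _).le

/-! ### Interpolating maps with prescribed end slopes -/

/-- A function on `[0,1]` with boundary values `u`, `v` and integral `1`. -/
def slopeFun (e : ℕ) (u v y : ℝ) : ℝ :=
  u * (1 - y) ^ e + v * y ^ e + 6 * (1 - (u + v) / (e + 1)) * (y * (1 - y))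

/-- The primitive of `slopeFun`. -/
def slopePrim (e : ℕ) (u v y : ℝ) : ℝ :=
  (u * (1 - (1 - y) ^ (e + 1)) + v * y ^ (e + 1)) / (e + 1) +
    6 * (1 - (u + v) / (e + 1)) * (y ^ 2 / 2 - y ^ 3 / 3)

theorem hasDerivAt_slopePrim (e : ℕ) (u v y : ℝ) :
    HasDerivAt (slopePrim e u v) (slopeFun e u v y) y := by
  have he : (e + 1 : ℝ) ≠ 0 := by positivity
  have h1 : HasDerivAt (fun y : ℝ => (1 - y) ^ (e + 1)) (((e + 1 : ℕ) : ℝ) * (1 - y) ^ e * (-1)) y := by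
    simpa using ((hasDerivAt_id y).const_sub 1).fun_pow (e + 1)
  have h2 : HasDerivAt (fun y : ℝ => y ^ (e + 1)) (((e + 1 : ℕ) : ℝ) * y ^ e) y := by
    simpa using hasDerivAt_pow (e + 1) y
  have h3 : HasDerivAt (fun y : ℝ => y ^ 2 / 2 - y ^ 3 / 3) (y * (1 - y)) y := by
    refine (((hasDerivAt_pow 2 y).div_const 2).sub ((hasDerivAt_pow 3 y).div_const 3)).congr_deriv ?_
    norm_num
    ring
  refine (((((h1.const_sub 1).const_mul u).add (h2.const_mul v)).div_const (e + 1 : ℝ)).add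
    (h3.const_mul (6 * (1 - (u + v) / (e + 1))))).congr_deriv ?_
  rw [slopeFun]
  push_cast
  field_simp

theorem continuous_slopeFun (e : ℕ) (v : ℝ) :
    Continuous fun z : ℝ × ℝ => slopeFun e z.1 v z.2 := by
  unfold slopeFun
  fun_prop

theorem slopeFun_pos {e : ℕ} {u v y : ℝ} (hu : 0 < u) (hv : 0 < v) (h : u + v < e + 1)
    (hy : y ∈ Icc (0 : ℝ) 1) : 0 < slopeFun e u v y := by
  have h1 : 0 ≤ 1 - (u + v) / (e + 1) := by
    rw [sub_nonneg, div_le_one (by positivity)]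
    exact h.le
  have h2 : 0 ≤ 1 - y := sub_nonneg.2 hy.2
  have h3 : 0 ≤ 6 * (1 - (u + v) / (e + 1)) * (y * (1 - y)) := by
    have := hy.1
    positivity
  rcases hy.1.eq_or_lt with h4 | h4
  · have : 0 < u * (1 - y) ^ e := by
      rw [← h4]
      simpa using hu
    have h5 : 0 ≤ v * y ^ e := mul_nonneg hv.le (pow_nonneg hy.1 _)
    unfold slopeFun
    linarith
  · have : 0 ≤ u * (1 - y) ^ e := by positivity
    have h5 : 0 < v * y ^ e := by positivity
    unfold slopeFun
    linarith

/-- The bound does not involve `e`, which is uncontrolled on the outermost glued translates. -/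
theorem slopeFun_le {e : ℕ} {u v y : ℝ} (hu : 0 < u) (hv : 0 < v) (hy : y ∈ Icc (0 : ℝ) 1) :
    slopeFun e u v y ≤ u + v + 6 := by
  have h1 : 1 - (u + v) / (e + 1) ≤ 1 := by
    have : 0 < (u + v) / (e + 1) := by positivity
    linarith
  have h2 : 0 ≤ 1 - y := sub_nonneg.2 hy.2
  have h0 := hy.1
  have e1 : u * (1 - y) ^ e ≤ u * 1 :=
    mul_le_mul_of_nonneg_left (pow_le_one₀ h2 (by linarith)) hu.le
  have e2 : v * y ^ e ≤ v * 1 := mul_le_mul_of_nonneg_left (pow_le_one₀ h0 hy.2) hv.le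
  have e3 : y * (1 - y) ≤ 1 := by nlinarith
  have e4 : (1 - (u + v) / (e + 1)) * (y * (1 - y)) ≤ 1 * (y * (1 - y)) :=
    mul_le_mul_of_nonneg_right h1 (mul_nonneg h0 h2)
  unfold slopeFun
  nlinarith

/-- Since `e > B`, the slopes are positive on the compact set `[c,B] × [0,1]`. The positive minimum
turns uniform continuity into a bound on the relative variation, uniform in `u`. -/
theorem exists_slopeFun_bounds {c B : ℝ} (hc : 0 < c) (hcB : c ≤ B) {e : ℕ} (he : B < e) :
    (∃ m, 0 < m ∧ ∀ u ∈ Icc c B, ∀ y ∈ Icc (0 : ℝ) 1, m ≤ slopeFun e u 1 y) ∧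
    ∀ η > 0, ∃ δ > 0, ∀ u ∈ Icc c B, ∀ y ∈ Icc (0 : ℝ) 1, ∀ z ∈ Icc (0 : ℝ) 1, |z - y| ≤ δ →
      |slopeFun e u 1 z - slopeFun e u 1 y| ≤ η * slopeFun e u 1 y := by
  have hK : IsCompact (Icc c B ×ˢ Icc (0 : ℝ) 1) := isCompact_Icc.prod isCompact_Icc
  have hcont := (continuous_slopeFun e 1).continuousOn (s := Icc c B ×ˢ Icc (0 : ℝ) 1)
  have hm : ∃ m, 0 < m ∧ ∀ u ∈ Icc c B, ∀ y ∈ Icc (0 : ℝ) 1, m ≤ slopeFun e u 1 y := by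
    obtain ⟨z, hz, hmin⟩ := hK.exists_isMinOn
      ⟨(c, 0), ⟨⟨le_rfl, hcB⟩, ⟨le_rfl, zero_le_one⟩⟩⟩ hcont
    refine ⟨_, slopeFun_pos (e := e) (hc.trans_le hz.1.1) one_pos ?_ hz.2, fun u hu y hy => ?_⟩
    · linarith [hz.1.2]
    · exact hmin (show (u, y) ∈ Icc c B ×ˢ Icc (0 : ℝ) 1 from ⟨hu, hy⟩)
  refine ⟨hm, fun η hη => ?_⟩
  obtain ⟨m, hm0, hm⟩ := hm
  have huc := hK.uniformContinuousOn_of_continuous hcont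
  rw [Metric.uniformContinuousOn_iff] at huc
  obtain ⟨δ, hδ, h⟩ := huc (η * m) (by positivity)
  refine ⟨δ / 2, by positivity, fun u hu y hy z hz hyz => ?_⟩
  have h1 := h (u, z) ⟨hu, hz⟩ (u, y) ⟨hu, hy⟩ (by
    rw [Prod.dist_eq, dist_self, Real.dist_eq]
    simp only [max_lt_iff]
    exact ⟨hδ, by linarith⟩)
  rw [Real.dist_eq] at h1
  exact h1.le.trans (mul_le_mul_of_nonneg_left (hm u hu y hy) hη.le)

/-- A map from `[p,q]` onto `[r,s]` whose derivative is a rescaled `slopeFun`. -/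
def interp (e : ℕ) (u v p q r s x : ℝ) : ℝ := r + (s - r) * slopePrim e u v ((x - p) / (q - p))

/-- The derivative of `interp`. -/
def interpDeriv (e : ℕ) (u v p q r s x : ℝ) : ℝ :=
  (s - r) / (q - p) * slopeFun e u v ((x - p) / (q - p))

theorem div_mem_unit {p q x : ℝ} (hpq : p < q) (hx : x ∈ Icc p q) :
    (x - p) / (q - p) ∈ Icc (0 : ℝ) 1 := by
  have h : 0 < q - p := sub_pos.2 hpq
  exact ⟨div_nonneg (sub_nonneg.2 hx.1) h.le, by rw [div_le_one h]; linarith [hx.2]⟩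

theorem posC1_interp {e : ℕ} {u v p q r s : ℝ} (hu : 0 < u) (hv : 0 < v) (h : u + v < e + 1)
    (hpq : p < q) (hrs : r < s) : PosC1 (interp e u v p q r s) (interpDeriv e u v p q r s) p q := by
  have hp : 0 < q - p := sub_pos.2 hpq
  refine PosC1.of_hasDerivAt (fun x => ?_) ?_ fun x hx => ?_
  · have h1 : HasDerivAt (fun x => (x - p) / (q - p)) (1 / (q - p)) x :=
      ((hasDerivAt_id x).sub_const p).div_const _
    refine ((((hasDerivAt_slopePrim e u v _).comp x h1).const_mul (s - r)).const_add r).congr_deriv ?_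
    rw [interpDeriv]
    field_simp
  · have : Continuous fun x : ℝ => ((u, (x - p) / (q - p)) : ℝ × ℝ) := by fun_prop
    exact continuous_const.mul ((continuous_slopeFun e v).comp this)
  · exact mul_pos (div_pos (sub_pos.2 hrs) hp) (slopeFun_pos hu hv h (div_mem_unit hpq hx))

section values
variable {e : ℕ} {u v p q r s : ℝ}

theorem interp_left : interp e u v p q r s p = r := by
  simp [interp, slopePrim]

theorem interp_right (hpq : p < q) : interp e u v p q r s q = s := by
  have : (e + 1 : ℝ) ≠ 0 := by positivity
  -- The integral of `y (1 - y)` over `[0,1]` is `1/6`, so the term with coefficient `6` supplies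
  -- exactly the mass missing from the two end terms.
  rw [interp, slopePrim, div_self (sub_pos.2 hpq).ne']
  simp only [sub_self, zero_pow (Nat.succ_ne_zero e), one_pow]
  field_simp
  ring

theorem interpDeriv_left (he : e ≠ 0) : interpDeriv e u v p q r s p = (s - r) / (q - p) * u := by
  simp [interpDeriv, slopeFun, he]

theorem interpDeriv_right (he : e ≠ 0) (hpq : p < q) :
    interpDeriv e u v p q r s q = (s - r) / (q - p) * v := by
  rw [interpDeriv, slopeFun, div_self (sub_pos.2 hpq).ne']
  simp [he]

end values

/-- There is a `C¹` map from `[p,q]` onto `[r,s]` with prescribed slopes at the end points. -/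
theorem exists_posC1_interp {p q r s u v : ℝ} (hpq : p < q) (hrs : r < s) (hu : 0 < u)
    (hv : 0 < v) :
    ∃ L L' : ℝ → ℝ, PosC1 L L' p q ∧ L p = r ∧ L q = s ∧ L' p = u ∧ L' q = v := by
  have hp : 0 < q - p := sub_pos.2 hpq
  have hr : 0 < s - r := sub_pos.2 hrs
  set u' := u * (q - p) / (s - r) with hu'
  set v' := v * (q - p) / (s - r) with hv'
  -- However steep the ends, a large exponent makes the two end terms carry mass less than 1.
  obtain ⟨e, he⟩ := exists_nat_gt (u' + v')
  have hu0 : 0 < u' := by positivity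
  have hv0 : 0 < v' := by positivity
  have he0 : e ≠ 0 := by
    rintro rfl
    rw [Nat.cast_zero] at he
    linarith
  refine ⟨_, _, posC1_interp (e := e) hu0 hv0 (by linarith) hpq hrs, interp_left,
    interp_right hpq, ?_, ?_⟩
  · rw [interpDeriv_left he0, hu']
    field_simp
  · rw [interpDeriv_right he0 hpq, hv']
    field_simp

/-! ### Gluing along the translates of a fundamental domain -/

namespace Diff

variable {a b : ℝ}

theorem zpow_add_one_ext (f : Diff a b) (i : ℤ) (x : ℝ) :
    (f ^ (i + 1)).ext x = (f ^ i).ext (f.ext x) := by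
  rw [zpow_add_one, ext_mul]

theorem zpow_ext_lt (f : Diff a b) {x₀ : ℝ} (h : x₀ < f.ext x₀) (i : ℤ) :
    (f ^ i).ext x₀ < (f ^ (i + 1)).ext x₀ := by
  rw [zpow_add_one_ext]
  exact (f ^ i).strictMono_ext h

theorem strictMono_zpow_ext (f : Diff a b) {x₀ : ℝ} (h : x₀ < f.ext x₀) :
    StrictMono fun i : ℤ => (f ^ i).ext x₀ :=
  strictMono_int_of_lt_succ (f.zpow_ext_lt h)

theorem mem_Ioo_of_ext_ne (f : Diff a b) {x : ℝ} (h : f.ext x ≠ x) : x ∈ Ioo a b := by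
  have hx : x ∈ Icc a b := by
    by_contra hx
    exact h (ext_of_notMem _ hx)
  refine ⟨hx.1.lt_of_ne ?_, hx.2.lt_of_ne ?_⟩
  · rintro rfl
    exact h f.ext_left
  · rintro rfl
    exact h f.ext_right

theorem ext_ext_ne (f : Diff a b) {x : ℝ} (h : f.ext x ≠ x) : f.ext (f.ext x) ≠ f.ext x :=
  fun h' => h (f.strictMono_ext.injective h')

theorem zpow_ext_mem_Ioo (f : Diff a b) {x : ℝ} (hx : x ∈ Ioo a b) (i : ℤ) :
    (f ^ i).ext x ∈ Ioo a b := by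
  have h1 := (f ^ i).strictMono_ext hx.1
  have h2 := (f ^ i).strictMono_ext hx.2
  rw [ext_left] at h1
  rw [ext_right] at h2
  exact ⟨h1, h2⟩

/-- A diffeomorphism fixing everything outside a segment is tangent to the identity at the ends. -/
theorem d_eq_one_of_fix (hab : a < b) (k : Diff a b) {p q x : ℝ} (hp : a < p) (hq : q < b)
    (h : ∀ x ∈ Icc a b, x ∉ Ioo p q → k.ext x = x) (hx : x ∈ Icc a b) (hx' : x ∉ Ioo p q) :
    k.d x = 1 := by
  rcases le_or_gt x p with h1 | h1
  · rcases lt_or_ge p b with hpb | hpb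
    · exact k.d_eq_one hp le_rfl hpb.le
        (fun y hy => h y ⟨hy.1, hy.2.trans hpb.le⟩ fun hy' => absurd hy'.1 (not_lt.2 hy.2))
        ⟨hx.1, h1⟩
    · exact k.d_eq_one hab le_rfl le_rfl
        (fun y hy => h y hy fun hy' => absurd hy'.1 (not_lt.2 (hy.2.trans hpb))) hx
  · have h2 : q ≤ x := by
      by_contra h2
      exact hx' ⟨h1, not_le.1 h2⟩
    refine k.d_eq_one (p := max a q) (q := b) (max_lt hab hq) (le_max_left _ _) le_rfl
      (fun y hy => h y ⟨(le_max_left _ _).trans hy.1, hy.2⟩ fun hy' => ?_) ⟨max_le hx.1 h2, hx.2⟩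
    exact absurd hy'.2 (not_lt.2 ((le_max_right _ _).trans hy.1))

section glued

variable {f k : Diff a b} {x₀ : ℝ}

/-- Pieces `A i ∘ k ∘ f⁻ⁱ` on the translates `fⁱ(I)` of a fundamental domain `I`, `|i| ≤ N`, are
glued together, and with the identity outside. -/
theorem exists_glued (hab : a < b) (hx₀ : x₀ < f.ext x₀)
    (hk : ∀ x ∈ Icc a b, x ∉ Ioo x₀ (f.ext x₀) → k.ext x = x) (N : ℕ) (A A' : ℤ → ℝ → ℝ)
    (s : ℤ → ℝ) (hs₁ : s (-N - 1) = (f ^ (-N - 1 : ℤ)).d (f.ext x₀))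
    (hs₂ : s N = (f ^ (N : ℤ)).d (f.ext x₀)) (hA : ∀ i, PosC1 (A i) (A' i) x₀ (f.ext x₀))
    (hA₁ : ∀ i, A i x₀ = (f ^ i).ext x₀) (hA₂ : ∀ i, A i (f.ext x₀) = (f ^ (i + 1)).ext x₀)
    (hA₁' : ∀ i, A' i x₀ = s (i - 1) * f.d x₀) (hA₂' : ∀ i, A' i (f.ext x₀) = s i) :
    ∃ T : Diff a b,
      (∀ x ∈ Icc a b, x ≤ (f ^ (-N : ℤ)).ext x₀ ∨ (f ^ (N + 1 : ℤ)).ext x₀ ≤ x →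
        T.ext x = x ∧ T.d x = 1) ∧
      ∀ i : ℤ, -N ≤ i → i ≤ N → ∀ x ∈ Icc x₀ (f.ext x₀),
        (T * f ^ i).d x = A' i (k.ext x) * k.d x := by
  have hIoo := f.mem_Ioo_of_ext_ne hx₀.ne'
  have hIoo' := f.mem_Ioo_of_ext_ne (f.ext_ext_ne hx₀.ne')
  have hmem := Ioo_subset_Icc_self hIoo
  have hmem' := Ioo_subset_Icc_self hIoo'
  have hk₁ := hk x₀ hmem fun h => lt_irrefl _ h.1
  have hk₂ := hk _ hmem' fun h => lt_irrefl _ h.2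
  have hk₁' := d_eq_one_of_fix hab k hIoo.1 hIoo'.2 hk hmem fun h => lt_irrefl _ h.1
  have hk₂' := d_eq_one_of_fix hab k hIoo.1 hIoo'.2 hk hmem' fun h => lt_irrefl _ h.2
  set X : ℤ → ℝ := fun i => (f ^ i).ext x₀ with hX
  have hXs : ∀ i, X (i + 1) = (f ^ i).ext (f.ext x₀) := fun i => zpow_add_one_ext f i x₀
  have hXm : StrictMono X := f.strictMono_zpow_ext hx₀
  have hXab : ∀ i, X i ∈ Icc a b := fun i => Ioo_subset_Icc_self (zpow_ext_mem_Ioo f hIoo i)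
  -- `φ i` brings the `i`-th translate back to the fundamental domain and applies `k`; `A i ∘ φ i`
  -- is the piece of `T` there.
  let φ : ℤ → Diff a b := fun i => k * f ^ (-i)
  have hφf : ∀ i, φ i * f ^ i = k := fun i => by
    simp only [φ, mul_assoc, ← zpow_add, neg_add_cancel, zpow_zero, mul_one]
  have hφ₁ : ∀ i, (φ i).ext (X i) = x₀ := fun i => by rw [hX]; simp only; rw [← ext_mul, hφf, hk₁]
  have hφ₂ : ∀ i, (φ i).ext (X (i + 1)) = f.ext x₀ := fun i => by rw [hXs, ← ext_mul, hφf, hk₂]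
  have hφ₁' : ∀ i, (φ i).d (X i) * (f ^ i).d x₀ = 1 := fun i => by
    rw [← hk₁', ← hφf i, d_mul hab _ _ hmem]
  have hφ₂' : ∀ i, (φ i).d (X (i + 1)) * (f ^ i).d (f.ext x₀) = 1 := fun i => by
    rw [← hk₂', hXs, ← hφf i, d_mul hab _ _ hmem']
  have hM : ∀ i, PosC1 (fun x => A i ((φ i).ext x)) (fun x => A' i ((φ i).ext x) * (φ i).d x)
      (X i) (X (i + 1)) := by
    intro i
    refine (hA i).comp (PosC1.of_diff hab _ (hXab _).1 (hXab _).2) fun x hx => ?_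
    have h1 := (φ i).strictMono_ext.monotone hx.1
    have h2 := (φ i).strictMono_ext.monotone hx.2
    rw [hφ₁] at h1
    rw [hφ₂] at h2
    exact ⟨h1, h2⟩
  have hpos : ∀ i, 0 < (f ^ i).d (f.ext x₀) := fun i => d_pos hab _ hmem'
  have hfd := f.d_pos hab hmem
  -- Pieces are attached from left to right. The last clause records the slope at the current right
  -- end, as needed for the next gluing; for `m = 0` it says that the slope 1 of the identity
  -- matches, by the choice of `s (-N - 1)`.
  have hind : ∀ m : ℕ, ∃ K K' : ℝ → ℝ, PosC1 K K' a (X (-N + m)) ∧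
      (∀ x ∈ Icc a (X (-N)), K x = x ∧ K' x = 1) ∧
      (∀ j : ℤ, 0 ≤ j → j < m → ∀ x ∈ Icc (X (-N + j)) (X (-N + j + 1)),
        K' x = A' (-N + j) ((φ (-N + j)).ext x) * (φ (-N + j)).d x) ∧
      K (X (-N + m)) = X (-N + m) ∧
      K' (X (-N + m)) * (f ^ (-N + m - 1 : ℤ)).d (f.ext x₀) = s (-N + m - 1) := by
    intro m
    induction m with
    | zero =>
      refine ⟨fun x => x, fun _ => 1, PosC1.id _ _, fun x _ => ⟨rfl, rfl⟩, ?_, rfl, ?_⟩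
      · intro j h1 h2
        omega
      · simp [hs₁]
    | succ m ih =>
      obtain ⟨K, K', hK, hK₁, hK₂, hK₃, hK₄⟩ := ih
      -- With `D(fⁱ)(x₀) = D(fⁱ⁻¹)(f x₀) Df(x₀)`, this matches the slopes of consecutive pieces.
      have e1 : (φ (-N + m)).d (X (-N + m)) *
          ((f ^ (-N + m - 1 : ℤ)).d (f.ext x₀) * f.d x₀) = 1 := by
        rw [← hφ₁' (-N + m), ← d_mul hab _ _ hmem, ← zpow_add_one]
        congr 3
        ring
      obtain ⟨G, G', hG, hG₁, hG₁', hG₂, hG₂'⟩ := hK.glue (hM (-N + m)) (hXab _).1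
        (hXm.monotone (by omega)) (by rw [hφ₁, hA₁, hK₃]) (by
          rw [hφ₁, hA₁', ← hK₄]
          linear_combination (-K' (X (-N + m))) * e1)
      have hcast : (-N + (m + 1 : ℕ) : ℤ) = -N + m + 1 := by push_cast; ring
      rw [hcast]
      have hend : X (-N + m + 1) ∈ Icc (X (-N + m)) (X (-N + m + 1)) :=
        ⟨hXm.monotone (by omega), le_rfl⟩
      refine ⟨G, G', hG, fun x hx => ?_, fun j hj hjm x hx => ?_, ?_, ?_⟩
      · have hx' : x ∈ Icc a (X (-N + m)) := ⟨hx.1, hx.2.trans (hXm.monotone (by omega))⟩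
        rw [hG₁ hx', hG₁' hx']
        exact hK₁ x hx
      · rcases (show j < m ∨ j = m by omega) with h | rfl
        · have hx' : x ∈ Icc a (X (-N + m)) :=
            ⟨(hXab _).1.trans hx.1, hx.2.trans (hXm.monotone (by omega))⟩
          rw [hG₁' hx']
          exact hK₂ j hj h x hx
        · exact hG₂' hx
      · rw [hG₂ hend]
        simp only [hφ₂, hA₂]
        rfl
      · rw [hG₂' hend]
        simp only [hφ₂, hA₂', add_sub_cancel_right]
        rw [mul_assoc, hφ₂', mul_one]
  obtain ⟨K, K', hK, hK₁, hK₂, hK₃, hK₄⟩ := hind (2 * N + 1)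
  have hcast : (-N + (2 * N + 1 : ℕ) : ℤ) = N + 1 := by push_cast; ring
  rw [hcast] at hK hK₃ hK₄
  rw [add_sub_cancel_right, hs₂] at hK₄
  -- The choice of `s N` makes the final slope 1, so that the identity can be attached on the right.
  have hK₄' : K' (X (N + 1)) = 1 := mul_right_cancel₀ (hpos N).ne' (hK₄.trans (one_mul _).symm)
  obtain ⟨G, G', hG, hG₁, hG₁', hG₂, hG₂'⟩ := hK.glue (PosC1.id _ b) (hXab _).1 (hXab _).2
    hK₃ hK₄'
  have hxa : a ∈ Icc a (X (-N)) := ⟨le_rfl, (hXab _).1⟩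
  have hsub : ∀ {x}, x ∈ Icc a (X (-N)) → x ∈ Icc a (X (N + 1)) := fun hx =>
    ⟨hx.1, hx.2.trans (hXm.monotone (by omega))⟩
  obtain ⟨T, hT, hT'⟩ := hG.exists_diff hab (by rw [hG₁ (hsub hxa), (hK₁ a hxa).1])
    (hG₂ ⟨(hXab _).2, le_rfl⟩)
  refine ⟨T, fun x hx h => ?_, fun i hi1 hi2 x hx => ?_⟩
  · rw [hT hx, hT' hx]
    rcases h with h | h
    · rw [hG₁ (hsub ⟨hx.1, h⟩), hG₁' (hsub ⟨hx.1, h⟩)]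
      exact hK₁ x ⟨hx.1, h⟩
    · exact ⟨hG₂ ⟨h, hx.2⟩, hG₂' ⟨h, hx.2⟩⟩
  · have hxab : x ∈ Icc a b := ⟨hmem.1.trans hx.1, hx.2.trans hmem'.2⟩
    have h1 : (f ^ i).ext x ∈ Icc (X i) (X (i + 1)) := by
      rw [hXs]
      exact ⟨(f ^ i).strictMono_ext.monotone hx.1, (f ^ i).strictMono_ext.monotone hx.2⟩
    have h2 : (f ^ i).ext x ∈ Icc a (X (N + 1)) :=
      ⟨(hXab _).1.trans h1.1, h1.2.trans (hXm.monotone (by omega))⟩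
    have h3 := hK₂ (i + N) (by omega) (by push_cast; omega) ((f ^ i).ext x)
    rw [show -(N : ℤ) + (i + N) = i by ring] at h3
    rw [d_mul hab _ _ hxab, hT' ((f ^ i).ext_mem hxab), hG₁' h2, h3 h1, ← ext_mul, hφf, mul_assoc,
      ← d_mul hab _ _ hxab, hφf]

end glued

end Diff

/-! ### Construction of the conjugating maps -/

namespace Diff

variable {a b : ℝ}

/-- The diffeomorphisms fixing `x` and tangent to the identity there. -/
def tangentSubgroup (hab : a < b) (x : ℝ) (hx : x ∈ Icc a b) : Subgroup (Diff a b) where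
  carrier := {φ | φ.ext x = x ∧ φ.d x = 1}
  one_mem' := ⟨ext_one x, d_one hab hx⟩
  mul_mem' := by
    rintro φ ψ ⟨h1, h2⟩ ⟨h3, h4⟩
    exact ⟨by rw [ext_mul, h3, h1], by rw [d_mul hab _ _ hx, h3, h2, h4, one_mul]⟩
  inv_mem' := by
    rintro φ ⟨h1, h2⟩
    have h3 := (ext_inv_eq_self_iff φ).2 h1
    exact ⟨h3, by rw [d_inv hab _ hx, h3, h2, inv_one]⟩

theorem zpow_tangent (hab : a < b) {f : Diff a b} (hf : f.NoHyperbolicFixedPoint) {x : ℝ}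
    (hx : x ∈ Icc a b) (h : f.ext x = x) (i : ℤ) : (f ^ i).ext x = x ∧ (f ^ i).d x = 1 :=
  (tangentSubgroup hab x hx).zpow_mem ⟨h, noHyperbolicFixedPoint_iff.1 hf x hx h⟩ i

/-- If a fixed point lay strictly between the two iterates, `f^(j-i)` would carry the lower iterate
to the upper one while staying below the fixed point. -/
theorem le_or_le_of_fixed (f : Diff a b) {x x₀ : ℝ} (h : f.ext x = x) (i j : ℤ) : x ≤ (f ^ i).ext x₀ ∨ (f ^ j).ext x₀ ≤ x := by
  have hfix : ∀ n : ℤ, (f ^ n).ext x = x := by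
    intro n
    have : f ^ n ∈ ({ carrier := {φ | φ.ext x = x}
                      one_mem' := ext_one x
                      mul_mem' := fun {φ ψ} (h1 : φ.ext x = x) (h2 : ψ.ext x = x) => by
                        exact (ext_mul φ ψ x).trans (by rw [h2, h1])
                      inv_mem' := fun {φ} h => (ext_inv_eq_self_iff φ).2 h } :
        Subgroup (Diff a b)) := Subgroup.zpow_mem _ h n
    exact this
  by_contra! h1
  have h2 := (f ^ (j - i)).strictMono_ext h1.1
  rw [← ext_mul, ← zpow_add, sub_add_cancel, hfix] at h2
  exact lt_asymm h2 h1.2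

theorem zpow_ext_sub_le (hab : a < b) (f : Diff a b) {x₀ M : ℝ} (hx₀ : x₀ ∈ Icc a b)
    (h : x₀ < f.ext x₀) (φ : Diff a b) (hφ : ∀ x ∈ Icc a b, φ.d x ≤ M) (i : ℤ) :
    φ.ext ((f ^ (i + 1)).ext x₀) - φ.ext ((f ^ i).ext x₀) ≤
      M * ((f ^ (i + 1)).ext x₀ - (f ^ i).ext x₀) :=
  φ.ext_sub_le hab hφ ((f ^ i).ext_mem hx₀).1 (f.zpow_ext_lt h i).le ((f ^ (i + 1)).ext_mem hx₀).2

/-- The ratios of the lengths of consecutive fundamental domains are bounded. -/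
theorem exists_ratio_bounds (hab : a < b) (f : Diff a b) {x₀ : ℝ} (h : x₀ < f.ext x₀) :
    ∃ c B : ℝ, 0 < c ∧ c ≤ B ∧ ∀ i : ℤ,
      ((f ^ i).ext x₀ - (f ^ (i - 1)).ext x₀) / ((f ^ (i + 1)).ext x₀ - (f ^ i).ext x₀) * f.d x₀ ∈
        Icc c B := by
  have hx₀ := Ioo_subset_Icc_self (f.mem_Ioo_of_ext_ne h.ne')
  obtain ⟨M, hM0, hM⟩ := f.exists_d_le hab
  obtain ⟨M', hM0', hM'⟩ := f⁻¹.exists_d_le hab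
  have hd := f.d_pos hab hx₀
  have key : ∀ i : ℤ,
      ((f ^ i).ext x₀ - (f ^ (i - 1)).ext x₀) / ((f ^ (i + 1)).ext x₀ - (f ^ i).ext x₀) * f.d x₀ ∈
        Icc (M⁻¹ * f.d x₀) (M' * f.d x₀) := by
    intro i
    -- The maps `f` and `f⁻¹` exchange consecutive translates, so the mean value inequality bounds
    -- the ratio on both sides.
    have h1 := zpow_ext_sub_le hab f hx₀ h f hM (i - 1)
    have h2 := zpow_ext_sub_le hab f hx₀ h f⁻¹ hM' i
    have e : ∀ j : ℤ, f.ext ((f ^ j).ext x₀) = (f ^ (j + 1)).ext x₀ := fun j => by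
      rw [← ext_mul, ← zpow_one_add, add_comm]
    have e' : ∀ j : ℤ, f⁻¹.ext ((f ^ j).ext x₀) = (f ^ (j - 1)).ext x₀ := fun j => by
      rw [← ext_mul, zpow_sub_one, ← zpow_neg_one, ← zpow_add, add_comm, zpow_add]
    rw [e, e, sub_add_cancel] at h1
    rw [e', e', add_sub_cancel_right] at h2
    have h3 := sub_pos.2 (f.zpow_ext_lt h i)
    constructor
    · refine mul_le_mul_of_nonneg_right ?_ hd.le
      rw [le_div_iff₀ h3, inv_mul_le_iff₀ hM0]
      exact h1
    · refine mul_le_mul_of_nonneg_right ?_ hd.le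
      rw [div_le_iff₀ h3]
      exact h2
  exact ⟨_, _, by positivity, (key 0).1.trans (key 0).2, key⟩

/-- The maps `T` used below: on `|i| < N`, the slope of `T ∘ fⁱ` on the fundamental domain is, up
to a multiplicative constant, taken in a fixed compact family, composed with `k`. -/
theorem exists_uniform_glued (hab : a < b) {f : Diff a b} {x₀ c B q C : ℝ}
    (hx₀ : x₀ < f.ext x₀) (hc : 0 < c)
    (hcB : ∀ i : ℤ, ((f ^ i).ext x₀ - (f ^ (i - 1)).ext x₀) /
      ((f ^ (i + 1)).ext x₀ - (f ^ i).ext x₀) * f.d x₀ ∈ Icc c B)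
    {e : ℕ} (he : B < e) (hq : 0 < q) (hq1 : q < 1)
    (hC : ∀ n : ℤ, ∀ x ∈ Icc a b, q ^ n.natAbs * (f ^ n).d x ≤ C)
    {k : Diff a b} (hk : ∀ x ∈ Icc a b, x ∉ Ioo x₀ (f.ext x₀) → k.ext x = x)
    {K : ℝ} (hK : ∀ x ∈ Icc a b, k.d x ≤ K) (N : ℕ) :
    ∃ T : Diff a b, (∀ x ∈ Icc a b, f.ext x = x → T.ext x = x ∧ T.d x = 1) ∧
      (∀ i : ℤ, i.natAbs < N → ∃ u ∈ Icc c B, ∀ x ∈ Icc x₀ (f.ext x₀), (T * f ^ i).d x =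
        ((f ^ (i + 1)).ext x₀ - (f ^ i).ext x₀) / (f.ext x₀ - x₀) *
          slopeFun e u 1 ((k.ext x - x₀) / (f.ext x₀ - x₀)) * k.d x) ∧
      ∀ i : ℤ, ∀ x ∈ Icc x₀ (f.ext x₀), q ^ i.natAbs * (T * f ^ i).d x ≤
        C + (C / q * f.d x₀ + 7 * C) * K := by
  have hIoo := f.mem_Ioo_of_ext_ne hx₀.ne'
  have hIoo' := f.mem_Ioo_of_ext_ne (f.ext_ext_ne hx₀.ne')
  have hmem := Ioo_subset_Icc_self hIoo
  have hmem' := Ioo_subset_Icc_self hIoo'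
  have hsub : ∀ {x}, x ∈ Icc x₀ (f.ext x₀) → x ∈ Icc a b := fun hx =>
    ⟨hmem.1.trans hx.1, hx.2.trans hmem'.2⟩
  have hk₁ := hk x₀ hmem fun h => lt_irrefl _ h.1
  have hk₂ := hk _ hmem' fun h => lt_irrefl _ h.2
  have hkI : ∀ {x}, x ∈ Icc x₀ (f.ext x₀) → k.ext x ∈ Icc x₀ (f.ext x₀) := fun {x} hx => by
    have h1 := k.strictMono_ext.monotone hx.1
    have h2 := k.strictMono_ext.monotone hx.2
    rw [hk₁] at h1
    rw [hk₂] at h2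
    exact ⟨h1, h2⟩
  set ℓ : ℤ → ℝ := fun i => (f ^ (i + 1)).ext x₀ - (f ^ i).ext x₀ with hℓ
  have hℓpos : ∀ i, 0 < ℓ i := fun i => sub_pos.2 (f.zpow_ext_lt hx₀ i)
  set l₀ : ℝ := f.ext x₀ - x₀ with hl₀
  have hl₀pos : 0 < l₀ := sub_pos.2 hx₀
  have hd := f.d_pos hab hmem
  have hK0 : 0 < K := (k.d_pos hab hmem).trans_le (hK _ hmem)
  have hC0 : 0 < C := (mul_pos (pow_pos hq _) ((f ^ (0 : ℤ)).d_pos hab hmem)).trans_le (hC 0 _ hmem)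
  -- Inside, the right end slope is the average slope of the piece, which normalises it to 1;
  -- outside it is the value forced by gluing with the identity. The range is asymmetric because the
  -- `i`-th piece involves both `s (i - 1)` and `s i`: for `|i| < N` both are average slopes.
  let s : ℤ → ℝ := fun i => if -N ≤ i ∧ i < N then ℓ i / l₀ else (f ^ i).d (f.ext x₀)
  have hs : ∀ i, 0 < s i := fun i => by
    simp only [s]
    split_ifs
    · exact div_pos (hℓpos i) hl₀pos
    · exact d_pos hab _ hmem'
  have hℓC : ∀ i : ℤ, q ^ i.natAbs * (ℓ i / l₀) ≤ C := by
    intro i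
    have h1 : ∀ x ∈ Icc a b, (f ^ i).d x ≤ C / q ^ i.natAbs := fun x hx => by
      rw [le_div_iff₀' (pow_pos hq _)]
      exact hC i x hx
    have h2 := (f ^ i).ext_sub_le hab h1 hmem.1 hx₀.le hmem'.2
    rw [← zpow_add_one_ext] at h2
    have h3 : ℓ i / l₀ ≤ C / q ^ i.natAbs := (div_le_iff₀ hl₀pos).2 h2
    rwa [le_div_iff₀' (pow_pos hq _)] at h3
  have hsC : ∀ i, q ^ i.natAbs * s i ≤ C := fun i => by
    simp only [s]
    split_ifs
    · exact hℓC i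
    · exact hC i _ hmem'
  let u : ℤ → ℝ := fun i => s (i - 1) * f.d x₀ * l₀ / ℓ i
  let v : ℤ → ℝ := fun i => s i * l₀ / ℓ i
  have hu : ∀ i, 0 < u i := fun i =>
    div_pos (mul_pos (mul_pos (hs _) hd) hl₀pos) (hℓpos i)
  have hv : ∀ i, 0 < v i := fun i => div_pos (mul_pos (hs _) hl₀pos) (hℓpos i)
  have hnice : ∀ i : ℤ, i.natAbs < N → v i = 1 ∧ u i ∈ Icc c B := by
    intro i hi
    have h1 : s i = ℓ i / l₀ := if_pos (by omega)
    have h2 : s (i - 1) = ℓ (i - 1) / l₀ := if_pos (by omega)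
    have h3 := (hℓpos i).ne'
    constructor
    · simp only [v, h1]
      field_simp
    · have h4 := hcB i
      have h5 : u i = ((f ^ i).ext x₀ - (f ^ (i - 1)).ext x₀) /
          ((f ^ (i + 1)).ext x₀ - (f ^ i).ext x₀) * f.d x₀ := by
        have h6 : ℓ (i - 1) = (f ^ i).ext x₀ - (f ^ (i - 1)).ext x₀ := by
          simp only [hℓ, sub_add_cancel]
        rw [← h6]
        change _ = ℓ (i - 1) / ℓ i * f.d x₀
        simp only [u, h2]
        field_simp
      rwa [h5]
  -- The common exponent `e` serves for `|i| < N`; elsewhere any exponent that ensures positivity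
  -- will do.
  have hexp : ∀ i : ℤ, ∃ n : ℕ, u i + v i < n + 1 ∧ n ≠ 0 ∧ (i.natAbs < N → n = e) := by
    intro i
    by_cases hi : i.natAbs < N
    · obtain ⟨h1, h2⟩ := hnice i hi
      refine ⟨e, by linarith [h2.2], ?_, fun _ => rfl⟩
      rintro rfl
      rw [Nat.cast_zero] at he
      linarith [h2.1, h2.2]
    · obtain ⟨n, hn⟩ := exists_nat_gt (u i + v i)
      refine ⟨n, by linarith, ?_, fun h => absurd h hi⟩
      rintro rfl
      rw [Nat.cast_zero] at hn
      linarith [hu i, hv i]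
  choose n hn hn0 hne using hexp
  obtain ⟨T, hT₁, hT₂⟩ := exists_glued hab hx₀ hk N
    (fun i => interp (n i) (u i) (v i) x₀ (f.ext x₀) ((f ^ i).ext x₀) ((f ^ (i + 1)).ext x₀))
    (fun i => interpDeriv (n i) (u i) (v i) x₀ (f.ext x₀) ((f ^ i).ext x₀) ((f ^ (i + 1)).ext x₀))
    s (if_neg (by omega)) (if_neg (by omega))
    (fun i => posC1_interp (hu i) (hv i) (hn i) hx₀ (f.zpow_ext_lt hx₀ i))
    (fun i => interp_left) (fun i => interp_right hx₀)
    (fun i => by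
      rw [interpDeriv_left (hn0 i)]
      change ℓ i / l₀ * u i = _
      have h3 := (hℓpos i).ne'
      simp only [u]
      field_simp)
    (fun i => by
      rw [interpDeriv_right (hn0 i) hx₀]
      change ℓ i / l₀ * v i = _
      have h3 := (hℓpos i).ne'
      simp only [v]
      field_simp)
  refine ⟨T, fun x hx h => hT₁ x hx (le_or_le_of_fixed f h _ _), fun i hi => ?_,
    fun i x hx => ?_⟩
  · obtain ⟨h1, h2⟩ := hnice i hi
    refine ⟨u i, h2, fun x hx => ?_⟩
    rw [hT₂ i (by omega) (by omega) x hx, hne i hi, h1]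
    rfl
  · have hkx := k.d_pos hab (hsub hx)
    by_cases hi : i.natAbs ≤ N
    · rw [hT₂ i (by omega) (by omega) x hx]
      -- Average slopes and derivatives of `fⁱ` obey the same growth bound, whichever occurs in `s`,
      -- so the estimate is independent of `N`.
      have h1 : interpDeriv (n i) (u i) (v i) x₀ (f.ext x₀) ((f ^ i).ext x₀)
          ((f ^ (i + 1)).ext x₀) (k.ext x) ≤ ℓ i / l₀ * (u i + v i + 6) :=
        mul_le_mul_of_nonneg_left (slopeFun_le (hu i) (hv i) (div_mem_unit hx₀ (hkI hx)))
          (div_pos (hℓpos i) hl₀pos).le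
      have h2 : ℓ i / l₀ * (u i + v i + 6) = s (i - 1) * f.d x₀ + s i + 6 * (ℓ i / l₀) := by
        have h3 := (hℓpos i).ne'
        simp only [u, v]
        field_simp
      have h3 : q ^ i.natAbs * s (i - 1) ≤ C / q := by
        rw [le_div_iff₀ hq]
        refine le_trans ?_ (hsC (i - 1))
        rw [mul_right_comm, ← pow_succ]
        exact mul_le_mul_of_nonneg_right (pow_le_pow_of_le_one hq.le hq1.le (by omega)) (hs _).le
      have h4 : q ^ i.natAbs * (ℓ i / l₀ * (u i + v i + 6)) ≤ C / q * f.d x₀ + 7 * C := by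
        have h5 := mul_le_mul_of_nonneg_right h3 hd.le
        have h6 := hsC i
        have h7 := hℓC i
        rw [h2]
        linarith
      have h8 := (mul_le_mul_of_nonneg_left h1 (pow_pos hq i.natAbs).le).trans h4
      have h9 : 0 ≤ C / q * f.d x₀ + 7 * C := by positivity
      have h10 := mul_le_mul h8 (hK x (hsub hx)) hkx.le h9
      rw [← mul_assoc]
      linarith
    · have h1 : T.d ((f ^ i).ext x) = 1 := by
        -- For `|i| > N` the translate lies where `T` is the identity.
        refine (hT₁ _ ((f ^ i).ext_mem (hsub hx)) ?_).2
        have hXm := (f.strictMono_zpow_ext hx₀).monotone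
        rcases (show i + 1 ≤ -N ∨ (N + 1 : ℤ) ≤ i by omega) with h | h
        · left
          refine le_trans ?_ (hXm h)
          simp only [zpow_add_one_ext]
          exact (f ^ i).strictMono_ext.monotone hx.2
        · right
          exact (hXm h).trans ((f ^ i).strictMono_ext.monotone hx.1)
      rw [d_mul hab _ _ (hsub hx), h1, one_mul]
      have h2 := hC i x (hsub hx)
      have h9 : 0 ≤ (C / q * f.d x₀ + 7 * C) * K := by positivity
      linarith

/-- A single conjugating map, with all estimates. -/
theorem exists_conjugator (hab : a < b) {f : Diff a b} (hf : f.NoHyperbolicFixedPoint) {x₀ : ℝ}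
    (hx₀ : x₀ < f.ext x₀) :
    ∃ κ : ℝ → ℝ, (∀ η > 0, 0 < κ η) ∧ ∀ q ε : ℝ, 0 < q → q < 1 → 0 < ε → ∀ k : Diff a b,
      (∀ x ∈ Icc a b, x ∉ Ioo x₀ (f.ext x₀) → k.ext x = x) →
      ∃ H : Diff a b, (∀ x ∈ Icc a b, f.ext x = x → H.ext x = x ∧ H.d x = 1) ∧
        (∀ x ∈ Icc a b, q ^ 4 * H.d x ≤ H.d (f.ext x) * f.d x ∧
          q ^ 2 * (H.d (f.ext x) * f.d x) ≤ (2 - q ^ 2) * H.d x) ∧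
        ∀ g : Diff a b, (∀ x ∈ Icc a b, x ∉ Ioo x₀ (f.ext x₀) → g.ext x = x) →
          ∀ C, (∀ x ∈ Icc a b, g.d x ≤ C) → ∀ η, 0 < η → η ≤ 1 → ConjNear (κ η) k g →
            ConjNear (3 * η + ε * (1 + C)) H g := by
  have hIoo := f.mem_Ioo_of_ext_ne hx₀.ne'
  have hIoo' := f.mem_Ioo_of_ext_ne (f.ext_ext_ne hx₀.ne')
  have hmem := Ioo_subset_Icc_self hIoo
  have hmem' := Ioo_subset_Icc_self hIoo'
  have hsub : ∀ {x}, x ∈ Icc x₀ (f.ext x₀) → x ∈ Icc a b := fun hx =>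
    ⟨hmem.1.trans hx.1, hx.2.trans hmem'.2⟩
  have hfixI : ∀ {k : Diff a b}, (∀ x ∈ Icc a b, x ∉ Ioo x₀ (f.ext x₀) → k.ext x = x) →
      ∀ {x}, x ∈ Icc x₀ (f.ext x₀) → k.ext x ∈ Icc x₀ (f.ext x₀) := fun {k} hk {x} hx => by
    have h1 := k.strictMono_ext.monotone hx.1
    have h2 := k.strictMono_ext.monotone hx.2
    rw [hk x₀ hmem fun h => lt_irrefl _ h.1] at h1
    rw [hk _ hmem' fun h => lt_irrefl _ h.2] at h2
    exact ⟨h1, h2⟩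
  have hl₀ : 0 < f.ext x₀ - x₀ := sub_pos.2 hx₀
  have hba : 0 < b - a := sub_pos.2 hab
  obtain ⟨c, B, hc, hcB, hratio⟩ := exists_ratio_bounds hab f hx₀
  obtain ⟨e, he⟩ := exists_nat_gt B
  obtain ⟨⟨m, hm0, hm⟩, hmod⟩ := exists_slopeFun_bounds hc hcB he
  have hmod' : ∀ η : ℝ, ∃ δ > 0, 0 < η → ∀ u ∈ Icc c B, ∀ y ∈ Icc (0 : ℝ) 1, ∀ z ∈ Icc (0 : ℝ) 1,
      |z - y| ≤ δ → |slopeFun e u 1 z - slopeFun e u 1 y| ≤ η * slopeFun e u 1 y := by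
    intro η
    by_cases hη : 0 < η
    · obtain ⟨δ, hδ, h⟩ := hmod η hη
      exact ⟨δ, hδ, fun _ => h⟩
    · exact ⟨1, one_pos, fun h => absurd h hη⟩
  choose δ hδ hδmod using hmod'
  -- The second term of the minimum bounds the displacement of `k g k⁻¹` by `δ η` times the length
  -- of the fundamental domain. The choice is independent of `q`, `ε` and `k`, which can therefore
  -- vary along a sequence.
  refine ⟨fun η => min η (δ η * (f.ext x₀ - x₀) / (b - a)),
    fun η hη => lt_min hη (div_pos (mul_pos (hδ η) hl₀) hba), ?_⟩
  intro q ε hq hq1 hε k hk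
  obtain ⟨C, hC0, hC⟩ := hf.exists_zpow_d_le hab hq hq1
  obtain ⟨K, hK0, hK⟩ := k.exists_d_le hab
  obtain ⟨K', hK0', hK'⟩ := k.exists_le_d hab
  set C₁ := C + (C / q * f.d x₀ + 7 * C) * K with hC₁
  have hC₁0 : 0 < C₁ := by
    have := f.d_pos hab hmem
    positivity
  -- `m * K'` is a lower bound for the term of index 0 on the fundamental domain, and `C₁` bounds
  -- the others independently of `N`, so `N` can be chosen now and `T` afterwards.
  obtain ⟨N, hN⟩ := exists_geometric_tail_le hq hq1 (show 0 < ε * (m * K') / C₁ by positivity)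
  obtain ⟨T, hT₁, hT₂, hT₃⟩ := exists_uniform_glued hab hx₀ hc hratio he hq hq1 hC hk hK (N + 1)
  obtain ⟨R, hR⟩ := exists_average_shift hab T f hq hq1 hC0 hC
  set w : ℤ → ℝ := fun i => q ^ (2 * i.natAbs) with hw
  have hwpos : ∀ i, 0 < w i := fun i => pow_pos hq _
  set W := ∑ i ∈ Finset.Icc (-R : ℤ) R, w i with hW
  have hWpos : 0 < W := Finset.sum_pos (fun i _ => hwpos i) ⟨0, by simp⟩
  obtain ⟨H, hH, hH'⟩ := exists_convexCombination hab (Finset.Icc (-R : ℤ) R) (fun i => W⁻¹ * w i)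
    (fun i => T * f ^ i) (fun i _ => (mul_pos (inv_pos.2 hWpos) (hwpos i)).le)
    (by rw [← Finset.mul_sum, inv_mul_cancel₀ hWpos.ne'])
  have hHd : ∀ x ∈ Icc a b, H.d x = W⁻¹ * ∑ i ∈ Finset.Icc (-R : ℤ) R, w i * (T * f ^ i).d x := by
    intro x hx
    rw [hH' x hx, Finset.mul_sum]
    exact Finset.sum_congr rfl fun i _ => mul_assoc _ _ _
  have hHg : ∀ g : Diff a b, ∀ x ∈ Icc a b, H.d (g.ext x) * g.d x =
      W⁻¹ * ∑ i ∈ Finset.Icc (-R : ℤ) R, w i * ((T * f ^ i).d (g.ext x) * g.d x) := by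
    intro g x hx
    rw [hHd _ (g.ext_mem hx), mul_assoc, Finset.sum_mul]
    simp only [mul_assoc]
  have hWi : 0 < W⁻¹ := inv_pos.2 hWpos
  refine ⟨H, fun x hx hfx => ?_, fun x hx => ?_, fun g hg Cg hCg η hη hη1 hnear x hx => ?_⟩
  · have h1 : ∀ i : ℤ, (T * f ^ i).ext x = x ∧ (T * f ^ i).d x = 1 := fun i =>
      (tangentSubgroup hab x hx).mul_mem (hT₁ x hx hfx) (zpow_tangent hab hf hx hfx i)
    constructor
    · rw [hH x hx]
      simp only [h1]
      rw [← Finset.sum_mul, ← Finset.mul_sum, inv_mul_cancel₀ hWpos.ne', one_mul]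
    · rw [hH' x hx]
      simp only [h1, mul_one]
      rw [← Finset.mul_sum, inv_mul_cancel₀ hWpos.ne']
  · have h1 : ∀ i : ℤ, (T * f ^ i).d (f.ext x) * f.d x = (T * f ^ (i + 1)).d x := fun i => by
      rw [← d_mul hab _ _ hx, mul_assoc, ← zpow_add_one]
    obtain ⟨h2, h3⟩ := hR x hx
    rw [hHg f x hx, hHd x hx]
    simp only [h1]
    constructor
    · have := mul_le_mul_of_nonneg_left h2 hWi.le
      linarith
    · have := mul_le_mul_of_nonneg_left h3 hWi.le
      linarith
  · by_cases hxI : x ∈ Ioo x₀ (f.ext x₀)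
    swap
    · rw [hg x hx hxI, d_eq_one_of_fix hab g hIoo.1 hIoo'.2 hg hx hxI, mul_one, sub_self, abs_zero]
      have h1 : 0 < Cg := (g.d_pos hab hx).trans_le (hCg x hx)
      have h2 := H.d_pos hab hx
      positivity
    · have hxI' := Ioo_subset_Icc_self hxI
      have hgxI := hfixI hg hxI'
      have hCg0 : 0 < Cg := (g.d_pos hab hx).trans_le (hCg x hx)
      have hkx := k.d_pos hab hx
      have hgx := g.d_pos hab hx
      set D : ℤ → ℝ := fun i => (T * f ^ i).d x with hD
      set D' : ℤ → ℝ := fun i => (T * f ^ i).d (g.ext x) * g.d x with hD'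
      have hDpos : ∀ i, 0 < D i := fun i => d_pos hab _ hx
      have hsmall : ∀ i : ℤ, i.natAbs < N + 1 → |D' i - D i| ≤ 3 * η * D i := by
        intro i hi
        obtain ⟨u, hu, hTu⟩ := hT₂ i hi
        have e1 := hTu x hxI'
        have e2 := hTu _ hgxI
        have hy := div_mem_unit hx₀ (hfixI hk hxI')
        have hz := div_mem_unit hx₀ (hfixI hk hgxI)
        have hyz : |(k.ext (g.ext x) - x₀) / (f.ext x₀ - x₀) -
            (k.ext x - x₀) / (f.ext x₀ - x₀)| ≤ δ η := by
          have h1 := abs_ext_sub_le hab (k * g * k⁻¹) ((conjNear_iff hab).1 hnear) (k.ext_mem hx)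
          rw [ext_mul, ext_inv_ext, ext_mul] at h1
          have h2 : min η (δ η * (f.ext x₀ - x₀) / (b - a)) * (b - a) ≤ δ η * (f.ext x₀ - x₀) := by
            refine (mul_le_mul_of_nonneg_right (min_le_right _ _) hba.le).trans ?_
            rw [div_mul_cancel₀ _ hba.ne']
          rw [← sub_div, sub_sub_sub_cancel_right, abs_div, abs_of_pos hl₀, div_le_iff₀ hl₀]
          exact h1.trans h2
        have h3 := hδmod η hη u hu _ hy _ hz hyz
        have h4 : |k.d (g.ext x) * g.d x - k.d x| ≤ η * k.d x :=
          (hnear x hx).trans (mul_le_mul_of_nonneg_right (min_le_left _ _) hkx.le)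
        have hP : 0 < slopeFun e u 1 ((k.ext x - x₀) / (f.ext x₀ - x₀)) :=
          hm0.trans_le (hm u hu _ hy)
        have hℓ : 0 < ((f ^ (i + 1)).ext x₀ - (f ^ i).ext x₀) / (f.ext x₀ - x₀) :=
          div_pos (sub_pos.2 (f.zpow_ext_lt hx₀ i)) hl₀
        simp only [hD, hD', e1, e2]
        generalize slopeFun e u 1 ((k.ext x - x₀) / (f.ext x₀ - x₀)) = P at *
        generalize slopeFun e u 1 ((k.ext (g.ext x) - x₀) / (f.ext x₀ - x₀)) = P' at *
        generalize ((f ^ (i + 1)).ext x₀ - (f ^ i).ext x₀) / (f.ext x₀ - x₀) = r at *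
        have e3 : r * P' * k.d (g.ext x) * g.d x - r * P * k.d x =
            r * ((P' - P) * (k.d (g.ext x) * g.d x) + P * (k.d (g.ext x) * g.d x - k.d x)) := by
          ring
        have hκ : 0 < k.d (g.ext x) * g.d x := mul_pos (k.d_pos hab (g.ext_mem hx)) hgx
        generalize k.d (g.ext x) * g.d x = κ' at *
        generalize k.d x = κ₀ at *
        -- This uses `η ≤ 1`. The variation of the slope then costs `2 η` and the distortion from
        -- `k` costs `η`, whence `3 η`.
        have h5 : κ' ≤ 2 * κ₀ := by
          have := (abs_le.1 h4).2
          nlinarith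
        rw [e3, abs_mul, abs_of_pos hℓ]
        have h6 : |(P' - P) * κ' + P * (κ' - κ₀)| ≤ η * P * (2 * κ₀) + P * (η * κ₀) := by
          refine (abs_add_le _ _).trans (add_le_add ?_ ?_)
          · rw [abs_mul, abs_of_pos hκ]
            exact mul_le_mul h3 h5 hκ.le (mul_pos hη hP).le
          · rw [abs_mul, abs_of_pos hP]
            exact mul_le_mul_of_nonneg_left h4 hP.le
        have h7 := mul_le_mul_of_nonneg_left h6 hℓ.le
        linarith
      have hlarge : ∀ i : ℤ, q ^ i.natAbs * |D' i - D i| ≤ C₁ * (1 + Cg) := by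
        intro i
        have h1 := hT₃ i x hxI'
        have h2 := hT₃ i _ hgxI
        have h3 : 0 < (T * f ^ i).d (g.ext x) := d_pos hab _ (g.ext_mem hx)
        have h4 : |D' i - D i| ≤ D' i + D i := by
          have h5 : 0 < D' i := mul_pos h3 hgx
          have := hDpos i
          rw [abs_le]
          constructor <;> linarith
        have h5 : q ^ i.natAbs * D' i ≤ C₁ * Cg := by
          simp only [hD', ← mul_assoc]
          exact mul_le_mul h2 (hCg x hx) hgx.le hC₁0.le
        have h6 := mul_le_mul_of_nonneg_left h4 (pow_pos hq i.natAbs).le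
        simp only [hD] at *
        linarith
      have hsum := abs_weightedSum_sub_le hq (Finset.Icc (-R : ℤ) R) D D' (N + 1) hDpos
        (by positivity) hsmall (fun i _ => hlarge i) (by positivity)
        (fun t ht => hN t fun i hi => (Nat.le_succ N).trans (ht i hi))
      have hD0 : m * K' ≤ D 0 := by
        obtain ⟨u, hu, hTu⟩ := hT₂ 0 (by simp)
        have e1 := hTu x hxI'
        rw [zero_add, zpow_one, zpow_zero, ext_one, div_self hl₀.ne', one_mul] at e1
        simp only [hD, zpow_zero]
        rw [e1]
        exact mul_le_mul (hm u hu _ (div_mem_unit hx₀ (hfixI hk hxI'))) (hK' x hx) hK0'.le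
          (hm0.le.trans (hm u hu _ (div_mem_unit hx₀ (hfixI hk hxI'))))
      have hS0 : D 0 ≤ ∑ i ∈ Finset.Icc (-R : ℤ) R, w i * D i := by
        have := Finset.single_le_sum (f := fun i => w i * D i)
          (fun i _ => (mul_pos (hwpos i) (hDpos i)).le)
          (show (0 : ℤ) ∈ Finset.Icc (-R : ℤ) R by simp)
        simpa [hw] using this
      rw [hHg g x hx, hHd x hx, ← mul_sub, abs_mul, abs_of_pos hWi, mul_left_comm]
      refine mul_le_mul_of_nonneg_left ?_ hWi.le
      refine hsum.trans ?_
      have h1 : C₁ * (1 + Cg) * (ε * (m * K') / C₁) = (1 + Cg) * (ε * (m * K')) := by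
        field_simp
      rw [h1, add_mul (3 * η)]
      refine add_le_add le_rfl ?_
      have h2 := mul_le_mul_of_nonneg_left (hD0.trans hS0) hε.le
      have h3 := mul_le_mul_of_nonneg_left h2 (show 0 ≤ 1 + Cg by linarith)
      refine h3.trans (le_of_eq ?_)
      ring

/-- The sequence of conjugating maps. -/
theorem exists_conjugator_seq (hab : a < b) {f : Diff a b} (hf : f.NoHyperbolicFixedPoint) {x₀ : ℝ}
    (hx₀ : x₀ < f.ext x₀) (S : Set (Diff a b))
    (hS : ∀ g ∈ S, ∀ x ∈ Icc a b, x ∉ Ioo x₀ (f.ext x₀) → g.ext x = x) (k : ℕ → Diff a b)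
    (hk : ∀ n, ∀ x ∈ Icc a b, x ∉ Ioo x₀ (f.ext x₀) → (k n).ext x = x)
    (hkS : ∀ g ∈ S, ∀ ε > 0, ∀ᶠ n in atTop, ConjNear ε (k n) g) :
    ∃ H : ℕ → Diff a b, (∀ n, ∀ x ∈ Icc a b, f.ext x = x → (H n).ext x = x ∧ (H n).d x = 1) ∧
      ∀ g ∈ insert f S, ∀ ε > 0, ∀ᶠ n in atTop, ConjNear ε (H n) g := by
  obtain ⟨κ, hκ, h⟩ := exists_conjugator hab hf hx₀
  have hε0 : ∀ n : ℕ, (0 : ℝ) < 1 / (n + 1) := fun n => by positivity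
  -- The index is advanced by one so that `q` is positive already for `n = 0`.
  have hq : ∀ n : ℕ, (0 : ℝ) < 1 - 1 / ((n + 1 : ℕ) + 1) ∧ (1 : ℝ) - 1 / ((n + 1 : ℕ) + 1) < 1 := by
    intro n
    have h1 : (1 : ℝ) / ((n + 1 : ℕ) + 1) < 1 := by
      rw [div_lt_one (by positivity)]
      push_cast
      have : (0 : ℝ) ≤ n := Nat.cast_nonneg n
      linarith
    exact ⟨by linarith, by linarith [hε0 (n + 1)]⟩
  choose H hH₁ hH₂ hH₃ using fun n => h _ _ (hq n).1 (hq n).2 (hε0 n) (k n) (hk n)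
  have ht0 : Tendsto (fun n : ℕ => (1 : ℝ) / (n + 1)) atTop (𝓝 0) :=
    tendsto_one_div_add_atTop_nhds_zero_nat
  have htq : Tendsto (fun n : ℕ => (1 : ℝ) - 1 / ((n + 1 : ℕ) + 1)) atTop (𝓝 1) := by
    simpa using (ht0.comp (tendsto_add_atTop_nat 1)).const_sub 1
  refine ⟨H, hH₁, fun g hg ε hε => ?_⟩
  rcases hg with rfl | hg
  · have h1 : Tendsto (fun q : ℝ => q ^ 4) (𝓝 1) (𝓝 1) := by
      simpa using (continuous_pow 4).tendsto (1 : ℝ)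
    have h2 : Tendsto (fun q : ℝ => (1 + ε) * q ^ 2 - (2 - q ^ 2)) (𝓝 1) (𝓝 ε) := by
      have : Continuous fun q : ℝ => (1 + ε) * q ^ 2 - (2 - q ^ 2) := by fun_prop
      convert this.tendsto 1 using 2
      ring
    filter_upwards [(h1.comp htq).eventually_const_lt (show 1 - ε < 1 by linarith),
      (h2.comp htq).eventually_const_lt (show (0 : ℝ) < ε from hε)] with n hn1 hn2 x hx
    obtain ⟨e1, e2⟩ := hH₂ n x hx
    have hp := (H n).d_pos hab hx
    have hqn := (hq n).1
    simp only [Function.comp] at hn1 hn2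
    generalize (1 : ℝ) - 1 / ((n + 1 : ℕ) + 1) = q at *
    rw [abs_le]
    constructor
    · nlinarith
    · have e3 : q ^ 2 * ((H n).d (g.ext x) * g.d x) ≤ q ^ 2 * ((1 + ε) * (H n).d x) := by
        nlinarith
      have := le_of_mul_le_mul_left e3 (by positivity)
      linarith
  · obtain ⟨C, hC0, hC⟩ := g.exists_d_le hab
    -- Then `3 η ≤ ε / 2`; the other half is left for the tail.
    have hη : 0 < min (ε / 6) 1 := by positivity
    have ht : Tendsto (fun n : ℕ => (1 : ℝ) / (n + 1) * (1 + C)) atTop (𝓝 0) := by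
      simpa using ht0.mul_const (1 + C)
    filter_upwards [hkS g hg _ (hκ _ hη), ht.eventually_lt_const (half_pos hε)] with n hn1 hn2
    refine (hH₃ n g (hS g hg) C hC _ hη (min_le_right _ _) hn1).mono hab ?_
    have := min_le_left (ε / 6) 1
    linarith

end Diff

/-! ### The semidirect product structure -/

namespace Diff

variable {a b : ℝ} {K : Type} [Group K]

/-- The conjugate of `ι k` by `fⁱ`. -/
def translate (f : Diff a b) (ι : K →* Diff a b) (i : ℤ) : K →* Diff a b :=
  (MulAut.conj (f ^ i)).toMonoidHom.comp ι

theorem translate_apply (f : Diff a b) (ι : K →* Diff a b) (i : ℤ) (k : K) :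
    translate f ι i k = f ^ i * ι k * (f ^ i)⁻¹ := rfl

theorem translate_ext (f : Diff a b) (ι : K →* Diff a b) (i : ℤ) (k : K) (x : ℝ) :
    (translate f ι i k).ext x = (f ^ i).ext ((ι k).ext ((f ^ (-i)).ext x)) := by
  rw [translate_apply, ext_mul, ext_mul, zpow_neg]

theorem zpow_neg_translate_ext (f : Diff a b) (ι : K →* Diff a b) (i : ℤ) (k : K) (x : ℝ) :
    (f ^ (-i)).ext ((translate f ι i k).ext x) = (ι k).ext ((f ^ (-i)).ext x) := by
  rw [translate_ext, ← ext_mul, ← zpow_add, neg_add_cancel, zpow_zero, ext_one]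

/-- `φ` acts on `fⁱ(U)` as the conjugate of `ι (u i)` by `fⁱ`, and trivially elsewhere. -/
def ActsAs (f : Diff a b) (ι : K →* Diff a b) (U : Set ℝ) (u : ℤ → K) (φ : Diff a b) : Prop :=
  ∀ x, (∀ i : ℤ, (f ^ (-i)).ext x ∈ U → φ.ext x = (translate f ι i (u i)).ext x) ∧
    ((∀ i : ℤ, (f ^ (-i)).ext x ∉ U) → φ.ext x = x)

section

variable {f : Diff a b} {ι : K →* Diff a b} {U : Set ℝ}

/-- Reduces identities between diffeomorphisms to identities between families `u`, such as the
homomorphism property and compatibility with the shift. -/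
theorem ActsAs.unique {u : ℤ → K} {φ ψ : Diff a b} (hφ : ActsAs f ι U u φ)
    (hψ : ActsAs f ι U u ψ) : φ = ψ := by
  refine eq_of_ext fun x _ => ?_
  by_cases h : ∃ i : ℤ, (f ^ (-i)).ext x ∈ U
  · obtain ⟨i, hi⟩ := h
    rw [(hφ x).1 i hi, (hψ x).1 i hi]
  · push Not at h
    rw [(hφ x).2 h, (hψ x).2 h]

theorem actsAs_one : ActsAs f ι U 1 1 := by
  refine fun x => ⟨fun i _ => ?_, fun _ => ext_one x⟩
  rw [Pi.one_apply, map_one]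

theorem ext_mem_of_fix (hU : ∀ k x, x ∉ U → (ι k).ext x = x) (k : K) {x : ℝ} (hx : x ∈ U) :
    (ι k).ext x ∈ U := by
  by_contra h
  have h1 := hU k⁻¹ _ h
  rw [map_inv, ext_inv_ext] at h1
  rw [← h1] at h
  exact h hx

theorem ActsAs.mul (hU : ∀ k x, x ∉ U → (ι k).ext x = x) {u v : ℤ → K} {φ ψ : Diff a b}
    (hφ : ActsAs f ι U u φ) (hψ : ActsAs f ι U v ψ) : ActsAs f ι U (u * v) (φ * ψ) := by
  refine fun x => ⟨fun i hi => ?_, fun h => ?_⟩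
  · rw [ext_mul, (hψ x).1 i hi, (hφ _).1 i, Pi.mul_apply, map_mul, ext_mul]
    rw [zpow_neg_translate_ext]
    exact ext_mem_of_fix hU _ hi
  · rw [ext_mul, (hψ x).2 h, (hφ x).2 h]

theorem ActsAs.conj {u : ℤ → K} {φ : Diff a b} (hφ : ActsAs f ι U u φ) (n : ℤ) :
    ActsAs f ι U (fun i => u (i - n)) (f ^ n * φ * (f ^ n)⁻¹) := by
  have key : ∀ (i : ℤ) (x : ℝ), (f ^ (-(i - n))).ext ((f ^ n)⁻¹.ext x) = (f ^ (-i)).ext x := by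
    intro i x
    rw [← zpow_neg, ← ext_mul, ← zpow_add]
    congr 2
    ring
  refine fun x => ⟨fun i hi => ?_, fun h => ?_⟩
  · rw [ext_mul, ext_mul, (hφ _).1 (i - n) (by rwa [key])]
    rw [translate_ext, key, ← ext_mul, ← zpow_add, add_sub_cancel, translate_ext]
  · rw [ext_mul, ext_mul, (hφ _).2, ext_ext_inv]
    intro i
    have := key (i + n) x
    rw [add_sub_cancel_right] at this
    rw [this]
    exact h _

theorem actsAs_mulSingle (hU : ∀ k x, x ∉ U → (ι k).ext x = x)
    (hd : ∀ n : ℤ, n ≠ 0 → ∀ x ∈ U, (f ^ n).ext x ∉ U) (j : ℤ) (k : K) :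
    ActsAs f ι U (Pi.mulSingle j k) (translate f ι j k) := by
  have key : ∀ x, (f ^ (-j)).ext x ∉ U → (translate f ι j k).ext x = x := fun x hx => by
    rw [translate_ext, hU k _ hx, ← ext_mul, ← zpow_add, add_neg_cancel, zpow_zero, ext_one]
  refine fun x => ⟨fun i hi => ?_, fun h => key x (h j)⟩
  rcases eq_or_ne i j with rfl | hij
  · rw [Pi.mulSingle_eq_same]
  · rw [Pi.mulSingle_eq_of_ne hij, map_one, ext_one]
    refine key x ?_
    have := hd (i - j) (sub_ne_zero.2 hij) _ hi
    rw [← ext_mul, ← zpow_add] at this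
    rwa [show i - j + -i = -j by ring] at this

/-- Induction on the support: one conjugate `fʲ ι(u j) f⁻ʲ` is multiplied on for each index `j`. -/
theorem exists_actsAs (hU : ∀ k x, x ∉ U → (ι k).ext x = x)
    (hd : ∀ n : ℤ, n ≠ 0 → ∀ x ∈ U, (f ^ n).ext x ∉ U) (s : Finset ℤ) :
    ∀ u : ℤ → K, (∀ i ∉ s, u i = 1) →
      ∃ φ ∈ Subgroup.closure (insert f (range ι)), ActsAs f ι U u φ := by
  have hf : f ∈ Subgroup.closure (insert f (range ι)) :=
    Subgroup.subset_closure (mem_insert _ _)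
  induction s using Finset.induction_on with
  | empty =>
    intro u hu
    obtain rfl : u = 1 := funext fun i => hu i (Finset.notMem_empty i)
    exact ⟨1, one_mem _, actsAs_one⟩
  | insert j s _ ih =>
    intro u hu
    obtain ⟨φ, hφ, hφ'⟩ := ih (Function.update u j 1) fun i hi => by
      rcases eq_or_ne i j with rfl | hij
      · simp
      · rw [Function.update_of_ne hij]
        exact hu i (by simp [hij, hi])
    refine ⟨translate f ι j (u j) * φ, mul_mem ?_ hφ, ?_⟩
    · rw [translate_apply]
      exact mul_mem (mul_mem (zpow_mem hf _)
        (Subgroup.subset_closure (mem_insert_of_mem _ (mem_range_self _))))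
        (inv_mem (zpow_mem hf _))
    · have := (actsAs_mulSingle hU hd j (u j)).mul hU hφ'
      convert this using 1
      funext i
      rcases eq_or_ne i j with rfl | hij
      · simp
      · simp [hij]

/-- If the translates of `U` by `f` are disjoint and `ι` takes values in the diffeomorphisms that
are trivial outside `U`, then `f` and the image of `ι` generate `(⊕_ℤ K) ⋊ ℤ`. -/
theorem isShiftProduct (hι : Function.Injective ι) (hU : ∀ k x, x ∉ U → (ι k).ext x = x)
    (hd : ∀ n : ℤ, n ≠ 0 → ∀ x ∈ U, (f ^ n).ext x ∉ U) {p : ℝ}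
    (hp : ∀ n : ℤ, (f ^ n).ext p ∉ U) (hp' : ∀ n : ℤ, n ≠ 0 → (f ^ n).ext p ≠ p) :
    IsShiftProduct f ι (Subgroup.closure (insert f (range ι))) := by
  have hex : ∀ u : directSum K, ∃ φ ∈ Subgroup.closure (insert f (range ι)),
      ActsAs f ι U u.1 φ := fun u => by
    have hfin : (Function.mulSupport u.1).Finite := u.2
    refine exists_actsAs hU hd hfin.toFinset u.1 fun i hi => ?_
    by_contra h
    exact hi (hfin.mem_toFinset.2 h)
  choose F hF hF' using hex
  let Φ : directSum K →* Diff a b :=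
    MonoidHom.mk' F fun u v => (hF' (u * v)).unique ((hF' u).mul hU (hF' v))
  let Ψ : (directSum K ⋊[directSum.shift K] Multiplicative ℤ) →* Diff a b :=
    SemidirectProduct.lift Φ (zpowersHom (Diff a b) f) fun n => by
      ext1 u
      exact (hF' _).unique ((hF' u).conj n.toAdd)
  have hΨ : ∀ z, Ψ z = F z.left * f ^ z.right.toAdd := fun z => rfl
  have hinj : Function.Injective Ψ := by
    rw [injective_iff_map_eq_one]
    intro z hz
    rw [hΨ] at hz
    have h1 : z.right.toAdd = 0 := by
      by_contra h
      apply hp' _ h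
      -- The orbit of `p` avoids every translate of `U`, so the direct sum part fixes it and only
      -- the power of `f` moves `p`.
      have h2 : (F z.left).ext ((f ^ z.right.toAdd).ext p) = (f ^ z.right.toAdd).ext p := by
        refine (hF' z.left _).2 fun i => ?_
        rw [← ext_mul, ← zpow_add]
        exact hp _
      rw [← h2, ← ext_mul, hz, ext_one]
    rw [h1, zpow_zero, mul_one] at hz
    refine SemidirectProduct.ext ?_ (Multiplicative.toAdd.injective h1)
    apply Subtype.ext
    funext i
    apply hι
    change ι (z.left.1 i) = ι 1
    rw [map_one]
    refine eq_of_ext fun x _ => ?_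
    rw [ext_one]
    by_cases hx : x ∈ U
    · have h3 : (f ^ (-i)).ext ((f ^ i).ext x) = x := by
        rw [← ext_mul, ← zpow_add, neg_add_cancel, zpow_zero, ext_one]
      have h2 := (hF' z.left ((f ^ i).ext x)).1 i (by rwa [h3])
      rw [hz, ext_one, translate_ext, h3] at h2
      exact ((f ^ i).strictMono_ext.injective h2).symm
    · exact hU _ _ hx
  have hf : f ∈ Subgroup.closure (insert f (range ι)) :=
    Subgroup.subset_closure (mem_insert _ _)
  have hone : ∀ k, F (directSum.single k) = ι k := fun k => by
    refine (hF' _).unique ?_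
    have := actsAs_mulSingle (f := f) hU hd 0 k
    rwa [translate_apply, zpow_zero, one_mul, inv_one, mul_one] at this
  have hΨf : Ψ (SemidirectProduct.inr (Multiplicative.ofAdd 1)) = f := by
    rw [SemidirectProduct.lift_inr]
    simp
  have hΨι : ∀ k, Ψ (SemidirectProduct.inl (directSum.single k)) = ι k := fun k => by
    rw [SemidirectProduct.lift_inl]
    exact hone k
  have hrange : Ψ.range = Subgroup.closure (insert f (range ι)) := by
    apply le_antisymm
    · rintro _ ⟨z, rfl⟩
      rw [hΨ]
      exact mul_mem (hF _) (zpow_mem hf _)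
    · rw [Subgroup.closure_le]
      rintro g (rfl | ⟨k, rfl⟩)
      · exact ⟨_, hΨf⟩
      · exact ⟨_, hΨι k⟩
  exact ⟨(MonoidHom.ofInjective hinj).trans (MulEquiv.subgroupCongr hrange), hΨf, hΨι⟩

end

theorem zpow_ext_notMem_Ioo (f : Diff a b) {x₀ : ℝ} (h : x₀ < f.ext x₀) (n : ℤ) :
    (f ^ n).ext x₀ ∉ Ioo x₀ (f.ext x₀) := by
  have hm := (f.strictMono_zpow_ext h).monotone
  intro hx
  rcases (show n ≤ 0 ∨ 1 ≤ n by omega) with h1 | h1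
  · have := hm h1
    simp only [zpow_zero, ext_one] at this
    exact absurd hx.1 (not_lt.2 this)
  · have := hm h1
    simp only [zpow_one] at this
    exact absurd hx.2 (not_lt.2 this)

theorem zpow_ext_notMem_Ioo_of_mem (f : Diff a b) {x₀ : ℝ} (h : x₀ < f.ext x₀) (n : ℤ)
    (hn : n ≠ 0) (x : ℝ) (hx : x ∈ Ioo x₀ (f.ext x₀)) : (f ^ n).ext x ∉ Ioo x₀ (f.ext x₀) := by
  have hm := (f.strictMono_zpow_ext h).monotone
  intro hx'
  rcases (show n + 1 ≤ 0 ∨ 1 ≤ n by omega) with h1 | h1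
  · have := hm h1
    simp only [zpow_zero, ext_one, zpow_add_one_ext] at this
    exact absurd (hx'.1.trans ((f ^ n).strictMono_ext hx.2)) (not_lt.2 this)
  · have := hm h1
    simp only [zpow_one] at this
    exact absurd (((f ^ n).strictMono_ext hx.1).trans hx'.2) (not_lt.2 this)

theorem zpow_ext_ne (f : Diff a b) {x₀ : ℝ} (h : x₀ < f.ext x₀) (n : ℤ) (hn : n ≠ 0) :
    (f ^ n).ext x₀ ≠ x₀ := by
  intro h1
  refine hn ((f.strictMono_zpow_ext h).injective ?_)
  simpa only [zpow_zero, ext_one] using h1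

end Diff

/-! ### Supports and extension from a subsegment -/

namespace Diff

variable {a b : ℝ}

/-- Were `y` moved, its image or its preimage would be a fixed point below `y`, contradicting
injectivity. -/
theorem ext_eq_of_forall_lt (g : Diff a b) {y : ℝ} (h : ∀ x < y, g.ext x = x) : g.ext y = y := by
  rcases lt_trichotomy (g.ext y) y with h1 | h1 | h1
  · exact g.strictMono_ext.injective (h _ h1)
  · exact h1
  · have h2 := g⁻¹.strictMono_ext h1
    rw [ext_inv_ext] at h2
    have h3 := h _ h2
    rw [ext_ext_inv] at h3
    exact absurd h3.symm h2.ne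

theorem ext_eq_of_forall_gt (g : Diff a b) {y : ℝ} (h : ∀ x > y, g.ext x = x) : g.ext y = y := by
  rcases lt_trichotomy (g.ext y) y with h1 | h1 | h1
  · have h2 := g⁻¹.strictMono_ext h1
    rw [ext_inv_ext] at h2
    have h3 := h _ h2
    rw [ext_ext_inv] at h3
    exact absurd h3 h2.ne
  · exact h1
  · exact g.strictMono_ext.injective (h _ h1)

theorem ext_eq_of_supp_subset (g : Diff a b) {y z : Icc a b} (h : g.supp ⊆ Icc y z) {x : ℝ}
    (hx : x ∉ Ioo (y : ℝ) z) : g.ext x = x := by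
  have key : ∀ x : ℝ, (x < y ∨ (z : ℝ) < x) → g.ext x = x := fun x hx => by
    by_cases hxab : x ∈ Icc a b
    · by_contra h1
      rw [ext_of_mem _ hxab] at h1
      have h2 : (⟨x, hxab⟩ : Icc a b) ∈ g.supp :=
        subset_closure fun h3 => h1 (congrArg Subtype.val h3)
      have h3 : (y : ℝ) ≤ x := (h h2).1
      have h4 : x ≤ (z : ℝ) := (h h2).2
      rcases hx with hx | hx <;> linarith
    · exact ext_of_notMem _ hxab
  rcases lt_trichotomy x y with h1 | h1 | h1
  · exact key x (Or.inl h1)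
  · rw [h1]
    exact ext_eq_of_forall_lt g fun w hw => key w (Or.inl hw)
  · rcases lt_trichotomy x z with h2 | h2 | h2
    · exact absurd ⟨h1, h2⟩ hx
    · rw [h2]
      exact ext_eq_of_forall_gt g fun w hw => key w (Or.inr hw)
    · exact key x (Or.inr h2)

/-- The map `k` is a diffeomorphism of `[a,b]` supported on `[p,r]` with the derivative of `h` on
`[c,d]`. -/
theorem exists_extension {c d p r : ℝ} (hap : a < p) (hpc : p < c) (hcd : c < d) (hdr : d < r)
    (hrb : r < b) (h : Diff c d) :
    ∃ k : Diff a b, (∀ x ∈ Icc a b, x ∉ Ioo p r → k.ext x = x) ∧ ∀ x ∈ Icc c d, k.d x = h.d x := by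
  -- The slopes of `h` at `c` and `d` are arbitrary; the collars `[p,c]` and `[d,r]` bring them back
  -- to 1.
  obtain ⟨L, L', hL, hL₁, hL₂, hL₁', hL₂'⟩ :=
    exists_posC1_interp hpc hpc one_pos (h.d_pos hcd (left_mem_Icc.2 hcd.le))
  obtain ⟨M, M', hM, hM₁, hM₂, hM₁', hM₂'⟩ :=
    exists_posC1_interp hdr hdr (h.d_pos hcd (right_mem_Icc.2 hcd.le)) one_pos
  obtain ⟨A, A', hA, hA₁, hA₁', hA₂, hA₂'⟩ :=
    (PosC1.id a p).glue hL hap.le hpc.le hL₁.symm hL₁'.symm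
  have hc : c ∈ Icc p c := right_mem_Icc.2 hpc.le
  obtain ⟨B, B', hB, hB₁, hB₁', hB₂, hB₂'⟩ :=
    hA.glue (PosC1.of_diff hcd h le_rfl le_rfl) (hap.trans hpc).le hcd.le
      (by rw [hA₂ hc, hL₂, h.ext_left]) (by rw [hA₂' hc, hL₂'])
  have hd : d ∈ Icc c d := right_mem_Icc.2 hcd.le
  obtain ⟨E, E', hE, hE₁, hE₁', hE₂, hE₂'⟩ :=
    hB.glue hM ((hap.trans hpc).trans hcd).le hdr.le
      (by rw [hB₂ hd, hM₁, h.ext_right]) (by rw [hB₂' hd, hM₁'])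
  have hr : r ∈ Icc d r := right_mem_Icc.2 hdr.le
  obtain ⟨F, F', hF, hF₁, hF₁', hF₂, hF₂'⟩ :=
    hE.glue (PosC1.id r b) (((hap.trans hpc).trans hcd).trans hdr).le hrb.le
      (by rw [hE₂ hr, hM₂]) (by rw [hE₂' hr, hM₂'])
  have hleft : ∀ x ∈ Icc a p, F x = x := fun x hx => by
    have h1 := hx.1
    have h2 := hx.2
    rw [hF₁ ⟨h1, by linarith⟩, hE₁ ⟨h1, by linarith⟩, hB₁ ⟨h1, by linarith⟩, hA₁ hx]
  have hright : ∀ x ∈ Icc r b, F x = x := fun x hx => hF₂ hx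
  have hab : a < b := by linarith
  obtain ⟨k, hk, hk'⟩ := hF.exists_diff hab (hleft a ⟨le_rfl, hap.le⟩) (hright b ⟨hrb.le, le_rfl⟩)
  refine ⟨k, fun x hx hx' => ?_, fun x hx => ?_⟩
  · rw [hk hx]
    rcases le_or_gt x p with h1 | h1
    · exact hleft x ⟨hx.1, h1⟩
    · exact hright x ⟨not_lt.1 fun h2 => hx' ⟨h1, h2⟩, hx.2⟩
  · have h1 := hx.1
    have h2 := hx.2
    rw [hk' ⟨by linarith, by linarith⟩, hF₁' ⟨by linarith, by linarith⟩,
      hE₁' ⟨by linarith, h2⟩, hB₂' hx]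

theorem exists_extension_by_id {c d : ℝ} (hac : a < c) (hcd : c < d) (hdb : d < b) (g : Diff c d)
    (hgc : g.d c = 1) (hgd : g.d d = 1) :
    ∃ ψ : Diff a b, (∀ x, ψ.ext x = g.ext x) ∧ ∀ x ∈ Icc c d, ψ.d x = g.d x := by
  obtain ⟨A, A', hA, hA₁, hA₁', hA₂, hA₂'⟩ :=
    (PosC1.id a c).glue (PosC1.of_diff hcd g le_rfl le_rfl) hac.le hcd.le g.ext_left.symm hgc.symm
  have hd : d ∈ Icc c d := right_mem_Icc.2 hcd.le
  obtain ⟨F, F', hF, hF₁, hF₁', hF₂, hF₂'⟩ :=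
    hA.glue (PosC1.id d b) (hac.trans hcd).le hdb.le
      (by rw [hA₂ hd, g.ext_right]) (by rw [hA₂' hd, hgd])
  have hab : a < b := by linarith
  have hFg : ∀ x ∈ Icc a b, F x = g.ext x := fun x hx => by
    rcases lt_or_ge x c with h1 | h1
    · rw [hF₁ ⟨hx.1, by linarith⟩, hA₁ ⟨hx.1, h1.le⟩,
        ext_of_notMem _ fun h => absurd h.1 (not_le.2 h1)]
    · rcases le_or_gt x d with h2 | h2
      · rw [hF₁ ⟨hx.1, h2⟩, hA₂ ⟨h1, h2⟩]
      · rw [hF₂ ⟨h2.le, hx.2⟩, ext_of_notMem _ fun h => absurd h.2 (not_le.2 h2)]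
  obtain ⟨ψ, hψ, hψ'⟩ := hF.exists_diff hab
    (by rw [hFg a ⟨le_rfl, hab.le⟩, ext_of_notMem _ fun h => absurd h.1 (not_le.2 hac)])
    (by rw [hFg b ⟨hab.le, le_rfl⟩, ext_of_notMem _ fun h => absurd h.2 (not_le.2 hdb)])
  refine ⟨ψ, fun x => ?_, fun x hx => ?_⟩
  · by_cases hx : x ∈ Icc a b
    · rw [hψ hx, hFg x hx]
    · rw [ext_of_notMem _ hx, ext_of_notMem _ fun h => hx ⟨hac.le.trans h.1, h.2.trans hdb.le⟩]
  · rw [hψ' ⟨hac.le.trans hx.1, hx.2.trans hdb.le⟩, hF₁' ⟨hac.le.trans hx.1, hx.2⟩, hA₂' hx]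

/-- The derivative at a common fixed point is invariant under conjugacy. -/
theorem d_eq_one_of_conjNear (hab : a < b) {H : ℕ → Diff a b} {g : Diff a b}
    (h : ∀ ε > 0, ∀ᶠ n in atTop, ConjNear ε (H n) g) {x : ℝ} (hx : x ∈ Icc a b)
    (hgx : g.ext x = x) : g.d x = 1 := by
  refine sub_eq_zero.1 (abs_eq_zero.1 (le_antisymm (le_of_forall_pos_le_add fun ε hε => ?_)
    (abs_nonneg _)))
  obtain ⟨n, hn⟩ := (h ε hε).exists
  have h1 := hn x hx
  have h2 := (H n).d_pos hab hx
  rw [hgx, ← mul_sub_one, abs_mul, abs_of_pos h2, mul_comm] at h1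
  rw [zero_add]
  exact le_of_mul_le_mul_right h1 h2

/-! ### The two cases of the theorem -/

/-- Common end of both cases. The conjugators are built for `F`, the one of `f` and `f⁻¹` that moves
`x₀` to the right: it has the same fixed points as `f` and generates the same group with `G`. The
shift product must still be expressed through `f`, hence the relation `fⁿ = F^(±n)`. -/
theorem conclusions_of_oriented (f F : Diff 0 1) (hf : f.NoHyperbolicFixedPoint)
    (hF : F = f ∨ F = f⁻¹) {x₀ : ℝ} (hx₀ : x₀ < F.ext x₀) {K : Type} [Group K]
    (ι : K →* Diff 0 1) (hι : Function.Injective ι)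
    (hfix : ∀ y x, x ∉ Ioo x₀ (F.ext x₀) → (ι y).ext x = x) (k : ℕ → Diff 0 1)
    (hk : ∀ n, ∀ x ∈ Icc (0 : ℝ) 1, x ∉ Ioo x₀ (F.ext x₀) → (k n).ext x = x)
    (hkι : ∀ y, ∀ ε > 0, ∀ᶠ n in atTop, ConjNear ε (k n) (ι y)) :
    IsC1CloseToId (Subgroup.closure (insert f (range ι))) ∧
    (∃ H : ℝ → Diff 0 1,
      IsIsotopyByConjugacyToId H (Subgroup.closure (insert f (range ι))) ∧
      ∀ t ∈ Ico (0 : ℝ) 1, (H t).supp ⊆ f.supp ∧ (H t).D 0 = 1 ∧ (H t).D 1 = 1) ∧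
    IsShiftProduct f ι (Subgroup.closure (insert f (range ι))) := by
  have h01 : (0 : ℝ) < 1 := one_pos
  have hFhyp : F.NoHyperbolicFixedPoint := by
    rcases hF with rfl | rfl
    · exact hf
    · exact hf.inv h01
  have hFfix : ∀ x, f.ext x = x → F.ext x = x := fun x hx => by
    rcases hF with rfl | rfl
    · exact hx
    · exact (ext_inv_eq_self_iff f).2 hx
  have hFpow : ∃ s : ℤ, (s = 1 ∨ s = -1) ∧ ∀ n : ℤ, f ^ n = F ^ (s * n) := by
    rcases hF with rfl | rfl
    · exact ⟨1, Or.inl rfl, fun n => by rw [one_mul]⟩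
    · exact ⟨-1, Or.inr rfl, fun n => by rw [inv_zpow', neg_one_mul, neg_neg]⟩
  obtain ⟨s, hs, hpow⟩ := hFpow
  obtain ⟨H, hH₁, hH₂⟩ := exists_conjugator_seq h01 hFhyp hx₀ (range ι)
    (by rintro _ ⟨y, rfl⟩ x - hx; exact hfix y x hx) k hk (by rintro _ ⟨y, rfl⟩; exact hkι y)
  have hconj : ∀ g ∈ insert f (range ι), ∀ ε > 0, ∀ᶠ n in atTop, ConjNear ε (H n) g := by
    intro g hg
    refine tendsto_conj_closure h01 hH₂ ?_
    rcases hg with rfl | hg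
    · have h1 : F ∈ Subgroup.closure (insert F (range ι)) :=
        Subgroup.subset_closure (mem_insert _ _)
      rcases hF with h | h
      · rwa [← h]
      · rw [← inv_inv g, ← h]
        exact inv_mem h1
    · exact Subgroup.subset_closure (mem_insert_of_mem _ hg)
  refine ⟨⟨H, fun g hg => (tendsto_conj_iff h01).2 (tendsto_conj_closure h01 hconj hg)⟩, ?_, ?_⟩
  · obtain ⟨J, hJ, hJ'⟩ := exists_isotopy h01 H _ hconj
    refine ⟨J, hJ, fun t _ => ?_⟩
    obtain ⟨n, r, hJe, hJd⟩ := hJ' t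
    refine ⟨closure_mono fun x hx hfx => hx (Subtype.ext ?_), ?_, ?_⟩
    · have h1 : f.ext x = x := by rw [ext_coe, hfx]
      have h2 := hH₁ n x x.2 (hFfix x h1)
      have h3 := hH₁ (n + 1) x x.2 (hFfix x h1)
      rw [← ext_coe, hJe x x.2, h2.1, h3.1]
      ring
    · have h0 : (0 : ℝ) ∈ Icc (0 : ℝ) 1 := left_mem_Icc.2 zero_le_one
      have h2 := hH₁ n 0 h0 F.ext_left
      have h3 := hH₁ (n + 1) 0 h0 F.ext_left
      rw [D_eq_d, Icc.coe_zero, hJd 0 h0, h2.2, h3.2]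
      ring
    · have h0 : (1 : ℝ) ∈ Icc (0 : ℝ) 1 := right_mem_Icc.2 zero_le_one
      have h2 := hH₁ n 1 h0 F.ext_right
      have h3 := hH₁ (n + 1) 1 h0 F.ext_right
      rw [D_eq_d, Icc.coe_one, hJd 1 h0, h2.2, h3.2]
      ring
  · have hsn : ∀ n : ℤ, n ≠ 0 → s * n ≠ 0 := fun n hn => by
      rcases hs with rfl | rfl <;> omega
    refine isShiftProduct hι hfix (fun n hn x hx => ?_) (p := x₀) (fun n => ?_) fun n hn => ?_
    · rw [hpow]
      exact zpow_ext_notMem_Ioo_of_mem F hx₀ _ (hsn n hn) x hx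
    · rw [hpow]
      exact zpow_ext_notMem_Ioo F hx₀ _
    · rw [hpow]
      exact zpow_ext_ne F hx₀ _ (hsn n hn)

end Diff

open Diff in
theorem conclusions_of_isotopy (f : Diff 0 1) (G : Subgroup (Diff 0 1)) (x₀ : Icc (0 : ℝ) 1)
    (h : ℝ → Diff 0 1) (hf : f.NoHyperbolicFixedPoint) (hx₀ : f.1 x₀ ≠ x₀)
    (hG : ∀ g ∈ G, g.supp ⊆ uIcc x₀ (f.1 x₀)) (hh : IsIsotopyByConjugacyToId h G)
    (hsupp : ∀ t ∈ Ico (0 : ℝ) 1, (h t).supp ⊆ uIcc x₀ (f.1 x₀)) :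
    IsC1CloseToId (Subgroup.closure (insert f (G : Set (Diff 0 1)))) ∧
    (∃ H : ℝ → Diff 0 1,
      IsIsotopyByConjugacyToId H (Subgroup.closure (insert f (G : Set (Diff 0 1)))) ∧
      ∀ t ∈ Ico (0 : ℝ) 1, (H t).supp ⊆ f.supp ∧ (H t).D 0 = 1 ∧ (H t).D 1 = 1) ∧
    IsShiftProduct f G.subtype (Subgroup.closure (insert f (G : Set (Diff 0 1)))) := by
  have hrange : (G : Set (Diff 0 1)) = range G.subtype := by simp
  have hor : ∃ (F : Diff 0 1) (y z : Icc (0 : ℝ) 1), (F = f ∨ F = f⁻¹) ∧ F.ext y = z ∧ y < z ∧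
      uIcc x₀ (f.1 x₀) = Icc y z := by
    rcases lt_or_gt_of_ne hx₀ with h1 | h1
    · refine ⟨f⁻¹, f.1 x₀, x₀, Or.inr rfl, ?_, h1, uIcc_of_ge h1.le⟩
      rw [← ext_coe, ext_inv_ext]
    · exact ⟨f, x₀, f.1 x₀, Or.inl rfl, ext_coe _ _, h1, uIcc_of_le h1.le⟩
  obtain ⟨F, y, z, hF, hyz, hlt, hI⟩ := hor
  rw [hI] at hG hsupp
  -- The given isotopy is sampled at times tending to 1; the new one is interpolated from the
  -- resulting conjugators.
  have ht : Tendsto (fun n : ℕ => (1 : ℝ) - 1 / (n + 1)) atTop (𝓝[<] 1) := by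
    refine tendsto_nhdsWithin_iff.2 ⟨?_, Eventually.of_forall fun n => ?_⟩
    · simpa using (tendsto_one_div_add_atTop_nhds_zero_nat (𝕜 := ℝ)).const_sub 1
    · have : (0 : ℝ) < 1 / (n + 1) := by positivity
      exact sub_lt_self _ this
  have ht' : ∀ n : ℕ, (1 : ℝ) - 1 / (n + 1) ∈ Ico (0 : ℝ) 1 := fun n => by
    have h1 : (0 : ℝ) < 1 / (n + 1) := by positivity
    have h2 : (1 : ℝ) / (n + 1) ≤ 1 := by
      rw [div_le_one (by positivity)]
      linarith [(Nat.cast_nonneg n : (0 : ℝ) ≤ n)]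
    exact ⟨by linarith, by linarith⟩
  rw [hrange]
  refine conclusions_of_oriented f F hf hF (x₀ := y) (by rw [hyz]; exact hlt) G.subtype
    G.subtype_injective (fun g x hx => ?_) (fun n => h (1 - 1 / (n + 1))) (fun n x _ hx => ?_)
    fun g => ?_
  · rw [hyz] at hx
    exact ext_eq_of_supp_subset _ (hG g g.2) hx
  · rw [hyz] at hx
    exact ext_eq_of_supp_subset _ (hsupp _ (ht' n)) hx
  · exact (tendsto_conj_iff one_pos).1 ((hh.2 g g.2).comp ht)

open Diff in
theorem conclusions_of_isC1CloseToId (f : Diff 0 1) (c d : ℝ) (G : Subgroup (Diff c d))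
    (hc : 0 < c) (hcd : c < d) (hd : d < 1) (hf : f.NoHyperbolicFixedPoint)
    (hdisj : Disjoint (f.ext '' Icc c d) (Icc c d)) (hG : IsC1CloseToId G) :
    ∃ ι : G →* Diff 0 1,
      (∀ (g : G) (x : ℝ), (ι g).ext x = (g : Diff c d).ext x) ∧
      IsC1CloseToId (Subgroup.closure (insert f (range ι))) ∧
      (∃ H : ℝ → Diff 0 1, IsIsotopyByConjugacyToId H (Subgroup.closure (insert f (range ι))) ∧
        ∀ t ∈ Ico (0 : ℝ) 1, (H t).supp ⊆ f.supp ∧ (H t).D 0 = 1 ∧ (H t).D 1 = 1) ∧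
      IsShiftProduct f ι (Subgroup.closure (insert f (range ι))) := by
  have hcm : c ∈ Icc c d := left_mem_Icc.2 hcd.le
  have hdm : d ∈ Icc c d := right_mem_Icc.2 hcd.le
  obtain ⟨h, hh⟩ := hG
  have hconj : ∀ g : G, ∀ ε > 0, ∀ᶠ n in atTop, ConjNear ε (h n) (g : Diff c d) := fun g =>
    (tendsto_conj_iff hcd).1 (hh g g.2)
  choose E hE hE' using fun g : G => exists_extension_by_id (a := 0) (b := 1) hc hcd hd
    (g : Diff c d) (d_eq_one_of_conjNear hcd (hconj g) hcm (ext_left _))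
    (d_eq_one_of_conjNear hcd (hconj g) hdm (ext_right _))
  let ι : G →* Diff 0 1 := MonoidHom.mk' E fun g g' => by
    apply ext_injective
    funext x
    rw [hE, ext_mul, hE, hE, Subgroup.coe_mul, ext_mul]
  have hιinj : Function.Injective ι := fun g g' hgg' => by
    apply Subtype.ext
    apply ext_injective
    funext x
    rw [← hE g x, ← hE g' x]
    exact congrArg (fun φ : Diff 0 1 => φ.ext x) hgg'
  have hor : ∃ F : Diff 0 1, (F = f ∨ F = f⁻¹) ∧ d < F.ext c := by
    have hnot : ∀ x ∈ Icc c d, f.ext x ∉ Icc c d := fun x hx =>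
      disjoint_left.1 hdisj (mem_image_of_mem _ hx)
    by_cases h1 : d < f.ext c
    · exact ⟨f, Or.inl rfl, h1⟩
    · refine ⟨f⁻¹, Or.inr rfl, ?_⟩
      have h2 : f.ext c < c := by
        by_contra h3
        exact hnot c hcm ⟨not_lt.1 h3, not_lt.1 h1⟩
      -- Otherwise the interval `f([c,d])` would reach `c`, by the intermediate value theorem, and
      -- meet `[c,d]`.
      have h3 : f.ext d < c := by
        by_contra h3
        have h4 : ContinuousOn f.ext (Icc c d) :=
          f.continuousOn_ext.mono (Icc_subset_Icc hc.le hd.le)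
        obtain ⟨x, hx, hxc⟩ := intermediate_value_Icc hcd.le h4 ⟨h2.le, not_lt.1 h3⟩
        exact hnot x hx (by rw [hxc]; exact hcm)
      have h4 := f⁻¹.strictMono_ext h3
      rwa [ext_inv_ext] at h4
  obtain ⟨F, hF, hFc⟩ := hor
  -- The fundamental domain `[F⁻¹ w, w]` then contains `[c,d]` in its interior, with room on both
  -- sides for the collars.
  obtain ⟨w, hdw, hwc⟩ := exists_between hFc
  have hFx : F.ext (F⁻¹.ext w) = w := ext_ext_inv _ _
  have hpc : F⁻¹.ext w < c := by
    have := F⁻¹.strictMono_ext hwc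
    rwa [ext_inv_ext] at this
  have hp0 : 0 < F⁻¹.ext w := by
    have := F⁻¹.strictMono_ext ((hc.trans hcd).trans hdw)
    rwa [ext_left] at this
  have hw1 : w < 1 := by
    have := F.strictMono_ext (hcd.trans hd)
    rw [ext_right] at this
    exact hwc.trans this
  choose k hk hk' using fun n => exists_extension hp0 hpc hcd hdw hw1 (h n)
  refine ⟨ι, hE, conclusions_of_oriented f F hf hF (x₀ := F⁻¹.ext w)
    (by rw [hFx]; exact (hpc.trans hcd).trans hdw) ι hιinj (fun g x hx => ?_) k ?_ fun g ε hε => ?_⟩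
  · refine (hE g x).trans (ext_of_notMem _ fun hx' => hx ⟨hpc.trans_le hx'.1, ?_⟩)
    rw [hFx]
    exact hx'.2.trans_lt hdw
  · rw [hFx]
    exact hk
  -- Only derivatives of the conjugators enter, so it suffices that those of `k n` and `h n` agree
  -- on `[c,d]`; off `[c,d]` the extension of `g` is tangent to the identity.
  · filter_upwards [hconj g ε hε] with n hn x hx
    change |(k n).d ((E g).ext x) * (E g).d x - (k n).d x| ≤ ε * (k n).d x
    by_cases hxI : x ∈ Icc c d
    · rw [hE, hE' g x hxI, hk' n x hxI, hk' n _ (ext_mem _ hxI)]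
      exact hn x hxI
    · have h1 : ∀ y ∈ Icc (0 : ℝ) 1, y ∉ Ioo c d → (E g).ext y = y := fun y _ hy => by
        rw [hE]
        by_cases hy' : y ∈ Icc c d
        · rcases hy'.1.eq_or_lt with rfl | h2
          · exact ext_left _
          · rcases hy'.2.eq_or_lt with rfl | h3
            · exact ext_right _
            · exact absurd ⟨h2, h3⟩ hy
        · exact ext_of_notMem _ hy'
      have h2 : x ∉ Ioo c d := fun h => hxI (Ioo_subset_Icc_self h)
      rw [h1 x hx h2, d_eq_one_of_fix one_pos (E g) hc hd h1 hx h2, mul_one, sub_self, abs_zero]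
      exact mul_nonneg hε.le (d_pos one_pos _ hx).le

end C1Close

end

theorem theorem3 :
    -- `G` and the isotopy are supported in a (closed) fundamental domain
    (∀ (f : C1Close.Diff 0 1) (G : Subgroup (C1Close.Diff 0 1)) (x₀ : Set.Icc (0 : ℝ) 1)
        (h : ℝ → C1Close.Diff 0 1),
      f.NoHyperbolicFixedPoint →
      f.1 x₀ ≠ x₀ →
      (∀ g ∈ G, g.supp ⊆ Set.uIcc x₀ (f.1 x₀)) →
      C1Close.IsIsotopyByConjugacyToId h G →
      (∀ t ∈ Set.Ico (0 : ℝ) 1, (h t).supp ⊆ Set.uIcc x₀ (f.1 x₀)) →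
      C1Close.IsC1CloseToId (Subgroup.closure (insert f (G : Set (C1Close.Diff 0 1)))) ∧
      (∃ H : ℝ → C1Close.Diff 0 1,
        C1Close.IsIsotopyByConjugacyToId H
          (Subgroup.closure (insert f (G : Set (C1Close.Diff 0 1)))) ∧
        ∀ t ∈ Set.Ico (0 : ℝ) 1, (H t).supp ⊆ f.supp ∧ (H t).D 0 = 1 ∧ (H t).D 1 = 1) ∧
      C1Close.IsShiftProduct f G.subtype
        (Subgroup.closure (insert f (G : Set (C1Close.Diff 0 1))))) ∧
    -- `G` lives on a segment contained in the interior of a fundamental domain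
    (∀ (f : C1Close.Diff 0 1) (c d : ℝ) (G : Subgroup (C1Close.Diff c d)),
      0 < c → c < d → d < 1 →
      f.NoHyperbolicFixedPoint →
      Disjoint (f.ext '' Set.Icc c d) (Set.Icc c d) →
      C1Close.IsC1CloseToId G →
      ∃ ι : G →* C1Close.Diff 0 1,
        (∀ (g : G) (x : ℝ), (ι g).ext x = (g : C1Close.Diff c d).ext x) ∧
        C1Close.IsC1CloseToId (Subgroup.closure (insert f (Set.range ι))) ∧
        (∃ H : ℝ → C1Close.Diff 0 1,
          C1Close.IsIsotopyByConjugacyToId H (Subgroup.closure (insert f (Set.range ι))) ∧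
          ∀ t ∈ Set.Ico (0 : ℝ) 1, (H t).supp ⊆ f.supp ∧ (H t).D 0 = 1 ∧ (H t).D 1 = 1) ∧
        C1Close.IsShiftProduct f ι (Subgroup.closure (insert f (Set.range ι)))) :=
  ⟨C1Close.conclusions_of_isotopy, C1Close.conclusions_of_isC1CloseToId⟩
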